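/- Let $\mathbb{K}$ be a field of characteristic $0$. All operads are symmetric operads in graded $\mathbb{K}$-vector spaces, with homological degree conventions; $\circ_i$ denotes partial composition and $x^\sigma$ the right action of the symmetric group. Let $\mathrm{cL}_\infty$ be the (shifted) curved L-infinity dg operad: the free symmetric operad on generators $\ell_n$, $n\ge 0$, of arity $n$ and degree $-1$, with $\ell_n^\sigma=\ell_n$ for all $\sigma\in\mathbb{S}_n$, endowed with the differential $$ d(\ell_n) = -\sum_{\substack{p+q=n\\ p,q\ge 0}}\ \sum_{\sigma}\ (\ell_{p+1}\circ_1 \ell_q)^{\sigma}, $$ where $\sigma$ runs over the unshuffles, i.e. the permutations $\sigma\in\mathbb{S}_n$ such that $\sigma^{-1}$ is increasing on $\{1,\dots,q\}$ and on $\{q+1,\dots,n\}$ (so the inner sum runs over all ways of choosing the $q$ inputs that are fed into $\ell_q$). Let $\mathrm{T}$ be the dg operad freely generated by an element $\alpha$ of arity $0$ and degree $0$ and an element $\kappa$ of arity $0$ and degree $-1$, with $d\alpha=\kappa$. Let $\mathrm{cL}_\infty\,\hat\vee\,\mathrm{T}$ be the completion of the coproduct $\mathrm{cL}_\infty\vee\mathrm{T}$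 of dg operads with respect to the filtration by the number of $\alpha$, taken in each arity and degree, with the induced dg operad structure. For an operation $x$ of arity $n+k$, write $x(\alpha^k,-)$ for the operation of arity $n$ obtained by inserting $\alpha$ into the first $k$ inputs of $x$. Then there is a unique morphism of symmetric dg operads $\eta:\mathrm{cL}_\infty\to\mathrm{cL}_\infty\,\hat\vee\,\mathrm{T}$ with $$ \eta(\ell_0)=\kappa+\sum_{k\ge 0}\frac{1}{k!}\,\ell_k(\alpha^k),\qquad \eta(\ell_n)=\sum_{k\ge 0}\frac{1}{k!}\,\ell_{k+n}(\alpha^k,-)\quad\text{for } n\ge 1 . $$ -/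

import Mathlib

universe u

namespace SymOp

open Equiv

/-- The Koszul sign `(-1)^a` as a scalar. -/
def ksign (K : Type u) [Field K] (a : ℤ) : K := ((a.negOnePow : ℤ) : K)

/-- The inputs of a composite `x ∘_i y` of an operation `x` with `m` inputs and an operation `y` with
`n` inputs (all counted from `0`): the inputs of `x` other than `i` and those of `y`, numbered from
left to right, the inputs of `y` taking the place of the input `i`. -/
def glue {m n r : ℕ} (h : m + n = r + 1) (i : Fin m) : {x : Fin m // x ≠ i} ⊕ Fin n ≃ Fin r where
  toFun := Sum.elim
    (fun x => if hx : x.1 < i then ⟨x.1, by omega⟩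
      else ⟨x.1 + n - 1, by have := x.2; have := x.1.2; omega⟩)
    (fun j => ⟨i + j, by omega⟩)
  invFun y :=
    if h1 : y.1 < i.1 then Sum.inl ⟨⟨y, by omega⟩, fun e => by simp [← e] at h1⟩
    else if h2 : y.1 < i.1 + n then Sum.inr ⟨y - i, by omega⟩
    else Sum.inl ⟨⟨y + 1 - n, by omega⟩, fun e => by simp [← e] at h1 h2; omega⟩
  left_inv := by
    rintro (⟨x, hx⟩ | j)
    · have hx' : x.1 ≠ i.1 := fun e => hx (Fin.ext e)
      by_cases h1 : x < i
      · simp [h1]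
      · have h3 : i.1 < x.1 := by simp at h1; have : i.1 ≤ x.1 := h1; omega
        have h4 : ¬ (x.1 + n - 1 < i.1) := by omega
        have h5 : ¬ (x.1 + n - 1 < i.1 + n) := by omega
        simp only [Sum.elim_inl, h1, dite_false, h4, h5]
        congr 2
        ext
        simp
        omega
    · simp
  right_inv := by
    intro y
    by_cases h1 : y.1 < i.1
    · have h3 : (⟨y.1, by omega⟩ : Fin m) < i := h1
      simp only [h1, dite_true, Sum.elim_inl, h3]
    · by_cases h2 : y.1 < i.1 + n
      · simp only [h1, h2, dite_true, dite_false, Sum.elim_inr]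
        ext; simp; omega
      · have h3 : ¬ ((⟨y.1 + 1 - n, by omega⟩ : Fin m) < i) := by
          rw [Fin.lt_def]; simp; omega
        simp only [h1, h2, dite_false, Sum.elim_inl, h3]
        ext; simp; omega

/-- The block permutation `σ ∘_i τ`: it acts by `σ` on the inputs of `x` other than `i`
and by `τ` on the inputs of `y`, which are moved as a block from the place `i` to the place `σ i`. -/
def blockPerm {m n r : ℕ} (h : m + n = r + 1) (i : Fin m) (σ : Perm (Fin m)) (τ : Perm (Fin n)) :
    Perm (Fin r) :=
  (glue h i).symm.trans ((Equiv.sumCongr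
    (σ.subtypeEquiv (p := fun x => x ≠ i) (q := fun x => x ≠ σ i) (by simp)) τ).trans
      (glue h (σ i)))

/-- A symmetric operad in `ℤ`-graded vector spaces over `K`, in terms of partial compositions:
`obj n a` is the space of operations of arity `n` and degree `a`, `act σ x` is `x^σ` (a right action:
the input `j` of `x^σ` is fed into the input `σ j` of `x`), and `comp _ _ i x y` is `x ∘_i y`, the
inputs of an operation being counted from `0`. The arity `r = m + n - 1` and the degree `c = a + b`
of a composite are given through equations. -/
structure GradedOperad (K : Type u) [Field K] where
  obj : ℕ → ℤ → Type u
  [acg : ∀ n a, AddCommGroup (obj n a)]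
  [mod : ∀ n a, Module K (obj n a)]
  act : ∀ {n : ℕ} {a : ℤ}, Perm (Fin n) → obj n a →ₗ[K] obj n a
  one : obj 1 0
  comp : ∀ {m n r : ℕ} {a b c : ℤ}, m + n = r + 1 → a + b = c → Fin m →
    obj m a →ₗ[K] obj n b →ₗ[K] obj r c
  act_one : ∀ {n : ℕ} {a : ℤ} (x : obj n a), act 1 x = x
  act_mul : ∀ {n : ℕ} {a : ℤ} (σ τ : Perm (Fin n)) (x : obj n a), act (σ * τ) x = act τ (act σ x)
  one_comp : ∀ {n : ℕ} {a : ℤ} (h : 1 + n = n + 1) (h' : 0 + a = a) (i : Fin 1) (x : obj n a),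
    comp h h' i one x = x
  comp_one : ∀ {n : ℕ} {a : ℤ} (h : n + 1 = n + 1) (h' : a + 0 = a) (i : Fin n) (x : obj n a),
    comp h h' i x one = x
  /-- sequential composition: `(x ∘_i y) ∘_{i + j} z = x ∘_i (y ∘_j z)` -/
  comp_assoc : ∀ {l m n s t v : ℕ} {a b c e f g : ℤ} (h₁ : l + m = s + 1) (h₂ : s + n = t + 1)
    (h₃ : m + n = v + 1) (h₄ : l + v = t + 1) (k₁ : a + b = e) (k₂ : e + c = f) (k₃ : b + c = g)
    (k₄ : a + g = f) (i : Fin l) (j : Fin m) (k : Fin s) (_ : (k : ℕ) = i + j)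
    (x : obj l a) (y : obj m b) (z : obj n c),
    comp h₂ k₂ k (comp h₁ k₁ i x y) z = comp h₄ k₄ i x (comp h₃ k₃ j y z)
  /-- parallel composition: `(x ∘_i y) ∘_{k + m - 1} z = (-1)^{|y||z|} (x ∘_k z) ∘_i y`
  for `i < k` -/
  comp_comm : ∀ {l m n s t v : ℕ} {a b c e f g : ℤ} (h₁ : l + m = s + 1) (h₂ : s + n = t + 1)
    (h₃ : l + n = v + 1) (h₄ : v + m = t + 1) (k₁ : a + b = e) (k₂ : e + c = f) (k₃ : a + c = g)
    (k₄ : g + b = f) (i k : Fin l) (i' : Fin v) (k' : Fin s) (_ : i < k) (_ : (i' : ℕ) = i)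
    (_ : (k' : ℕ) + 1 = k + m) (x : obj l a) (y : obj m b) (z : obj n c),
    comp h₂ k₂ k' (comp h₁ k₁ i x y) z = ksign K (b * c) • comp h₄ k₄ i' (comp h₃ k₃ k x z) y
  /-- equivariance: `x^σ ∘_i y^τ = (x ∘_{σ i} y)^{σ ∘_i τ}` -/
  comp_act : ∀ {m n r : ℕ} {a b c : ℤ} (h : m + n = r + 1) (h' : a + b = c) (i : Fin m)
    (σ : Perm (Fin m)) (τ : Perm (Fin n)) (x : obj m a) (y : obj n b),
    comp h h' i (act σ x) (act τ y) = act (blockPerm h i σ τ) (comp h h' (σ i) x y)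

attribute [instance] GradedOperad.acg GradedOperad.mod

/-- A derivation of (homological) degree `-1` of a graded operad. -/
structure Derivation {K : Type u} [Field K] (P : GradedOperad K) where
  toFun : ∀ {n : ℕ} {a : ℤ}, P.obj n a →ₗ[K] P.obj n (a - 1)
  map_act : ∀ {n : ℕ} {a : ℤ} (σ : Perm (Fin n)) (x : P.obj n a),
    toFun (P.act σ x) = P.act σ (toFun x)
  /-- Leibniz rule: `d (x ∘_i y) = d x ∘_i y + (-1)^{|x|} x ∘_i d y` -/
  map_comp : ∀ {m n r : ℕ} {a b c : ℤ} (h : m + n = r + 1) (h' : a + b = c) (i : Fin m)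
    (x : P.obj m a) (y : P.obj n b),
    toFun (P.comp h h' i x y) = P.comp h (show a - 1 + b = c - 1 by omega) i (toFun x) y +
      ksign K a • P.comp h (show a + (b - 1) = c - 1 by omega) i x (toFun y)

/-- A symmetric dg operad over `K` (homological degree conventions). -/
structure DGOperad (K : Type u) [Field K] where
  op : GradedOperad K
  d : Derivation op
  d_d : ∀ {n : ℕ} {a : ℤ} (x : op.obj n a), d.toFun (d.toFun x) = 0

/-- A morphism of symmetric dg operads. -/
structure DGOperad.Hom {K : Type u} [Field K] (P Q : DGOperad K) where
  toFun : ∀ {n : ℕ} {a : ℤ}, P.op.obj n a →ₗ[K] Q.op.obj n a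
  map_one : toFun P.op.one = Q.op.one
  map_act : ∀ {n : ℕ} {a : ℤ} (σ : Perm (Fin n)) (x : P.op.obj n a),
    toFun (P.op.act σ x) = Q.op.act σ (toFun x)
  map_comp : ∀ {m n r : ℕ} {a b c : ℤ} (h : m + n = r + 1) (h' : a + b = c) (i : Fin m)
    (x : P.op.obj m a) (y : P.op.obj n b),
    toFun (P.op.comp h h' i x y) = Q.op.comp h h' i (toFun x) (toFun y)
  map_d : ∀ {n : ℕ} {a : ℤ} (x : P.op.obj n a), toFun (P.d.toFun x) = Q.d.toFun (toFun x)

/-- Formal expressions in the operations of a graded operad, in generators `G n a` of arity `n` and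
degree `a`. -/
inductive Term (K : Type u) (G : ℕ → ℤ → Type u) : ℕ → ℤ → Type u
  | gen {n : ℕ} {a : ℤ} : G n a → Term K G n a
  | zero {n : ℕ} {a : ℤ} : Term K G n a
  | add {n : ℕ} {a : ℤ} : Term K G n a → Term K G n a → Term K G n a
  | smul {n : ℕ} {a : ℤ} : K → Term K G n a → Term K G n a
  | act {n : ℕ} {a : ℤ} : Perm (Fin n) → Term K G n a → Term K G n a
  | one : Term K G 1 0
  | comp {m n r : ℕ} {a b c : ℤ} (h : m + n = r + 1) (h' : a + b = c) (i : Fin m) :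
      Term K G m a → Term K G n b → Term K G r c

/-- The smallest congruence on formal expressions that contains the relations `R` and the axioms of
a graded operad. -/
inductive Rel {K : Type u} [Field K] {G : ℕ → ℤ → Type u}
    (R : ∀ n a, Term K G n a → Term K G n a → Prop) :
    ∀ {n : ℕ} {a : ℤ}, Term K G n a → Term K G n a → Prop
  | of {n : ℕ} {a : ℤ} {x y : Term K G n a} : R n a x y → Rel R x y
  | refl {n : ℕ} {a : ℤ} (x : Term K G n a) : Rel R x x
  | symm {n : ℕ} {a : ℤ} {x y : Term K G n a} : Rel R x y → Rel R y x
  | trans {n : ℕ} {a : ℤ} {x y z : Term K G n a} : Rel R x y → Rel R y z → Rel R x z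
  | add_congr {n : ℕ} {a : ℤ} {x x' y y' : Term K G n a} : Rel R x x' → Rel R y y' →
      Rel R (x.add y) (x'.add y')
  | smul_congr {n : ℕ} {a : ℤ} (k : K) {x x' : Term K G n a} : Rel R x x' →
      Rel R (x.smul k) (x'.smul k)
  | act_congr {n : ℕ} {a : ℤ} (σ : Perm (Fin n)) {x x' : Term K G n a} : Rel R x x' →
      Rel R (x.act σ) (x'.act σ)
  | comp_congr {m n r : ℕ} {a b c : ℤ} (h : m + n = r + 1) (h' : a + b = c) (i : Fin m)
      {x x' : Term K G m a} {y y' : Term K G n b} : Rel R x x' → Rel R y y' →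
      Rel R (.comp h h' i x y) (.comp h h' i x' y')
  | add_assoc {n : ℕ} {a : ℤ} (x y z : Term K G n a) :
      Rel R ((x.add y).add z) (x.add (y.add z))
  | add_comm {n : ℕ} {a : ℤ} (x y : Term K G n a) : Rel R (x.add y) (y.add x)
  | zero_add {n : ℕ} {a : ℤ} (x : Term K G n a) : Rel R (Term.zero.add x) x
  | one_smul {n : ℕ} {a : ℤ} (x : Term K G n a) : Rel R (x.smul 1) x
  | zero_smul {n : ℕ} {a : ℤ} (x : Term K G n a) : Rel R (x.smul 0) .zero
  | mul_smul {n : ℕ} {a : ℤ} (k l : K) (x : Term K G n a) :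
      Rel R (x.smul (k * l)) ((x.smul l).smul k)
  | add_smul {n : ℕ} {a : ℤ} (k l : K) (x : Term K G n a) :
      Rel R (x.smul (k + l)) ((x.smul k).add (x.smul l))
  | smul_add {n : ℕ} {a : ℤ} (k : K) (x y : Term K G n a) :
      Rel R ((x.add y).smul k) ((x.smul k).add (y.smul k))
  | act_add {n : ℕ} {a : ℤ} (σ : Perm (Fin n)) (x y : Term K G n a) :
      Rel R ((x.add y).act σ) ((x.act σ).add (y.act σ))
  | act_smul {n : ℕ} {a : ℤ} (σ : Perm (Fin n)) (k : K) (x : Term K G n a) :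
      Rel R ((x.smul k).act σ) ((x.act σ).smul k)
  | add_comp {m n r : ℕ} {a b c : ℤ} (h : m + n = r + 1) (h' : a + b = c) (i : Fin m)
      (x y : Term K G m a) (z : Term K G n b) :
      Rel R (.comp h h' i (x.add y) z) (.add (.comp h h' i x z) (.comp h h' i y z))
  | smul_comp {m n r : ℕ} {a b c : ℤ} (h : m + n = r + 1) (h' : a + b = c) (i : Fin m) (k : K)
      (x : Term K G m a) (z : Term K G n b) :
      Rel R (.comp h h' i (x.smul k) z) (.smul k (.comp h h' i x z))
  | comp_add {m n r : ℕ} {a b c : ℤ} (h : m + n = r + 1) (h' : a + b = c) (i : Fin m)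
      (x : Term K G m a) (y z : Term K G n b) :
      Rel R (.comp h h' i x (y.add z)) (.add (.comp h h' i x y) (.comp h h' i x z))
  | comp_smul {m n r : ℕ} {a b c : ℤ} (h : m + n = r + 1) (h' : a + b = c) (i : Fin m) (k : K)
      (x : Term K G m a) (z : Term K G n b) :
      Rel R (.comp h h' i x (z.smul k)) (.smul k (.comp h h' i x z))
  | act_one {n : ℕ} {a : ℤ} (x : Term K G n a) : Rel R (x.act 1) x
  | act_mul {n : ℕ} {a : ℤ} (σ τ : Perm (Fin n)) (x : Term K G n a) :
      Rel R (x.act (σ * τ)) ((x.act σ).act τ)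
  | one_comp {n : ℕ} {a : ℤ} (h : 1 + n = n + 1) (h' : 0 + a = a) (i : Fin 1) (x : Term K G n a) :
      Rel R (.comp h h' i .one x) x
  | comp_one {n : ℕ} {a : ℤ} (h : n + 1 = n + 1) (h' : a + 0 = a) (i : Fin n) (x : Term K G n a) :
      Rel R (.comp h h' i x .one) x
  | comp_assoc {l m n s t v : ℕ} {a b c e f g : ℤ} (h₁ : l + m = s + 1) (h₂ : s + n = t + 1)
      (h₃ : m + n = v + 1) (h₄ : l + v = t + 1) (k₁ : a + b = e) (k₂ : e + c = f)
      (k₃ : b + c = g) (k₄ : a + g = f) (i : Fin l) (j : Fin m) (k : Fin s)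
      (hk : (k : ℕ) = i + j) (x : Term K G l a) (y : Term K G m b) (z : Term K G n c) :
      Rel R (.comp h₂ k₂ k (.comp h₁ k₁ i x y) z) (.comp h₄ k₄ i x (.comp h₃ k₃ j y z))
  | comp_comm {l m n s t v : ℕ} {a b c e f g : ℤ} (h₁ : l + m = s + 1) (h₂ : s + n = t + 1)
      (h₃ : l + n = v + 1) (h₄ : v + m = t + 1) (k₁ : a + b = e) (k₂ : e + c = f)
      (k₃ : a + c = g) (k₄ : g + b = f) (i k : Fin l) (i' : Fin v) (k' : Fin s) (hik : i < k)
      (hi : (i' : ℕ) = i) (hk : (k' : ℕ) + 1 = k + m)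
      (x : Term K G l a) (y : Term K G m b) (z : Term K G n c) :
      Rel R (.comp h₂ k₂ k' (.comp h₁ k₁ i x y) z)
        (.smul (ksign K (b * c)) (.comp h₄ k₄ i' (.comp h₃ k₃ k x z) y))
  | comp_act {m n r : ℕ} {a b c : ℤ} (h : m + n = r + 1) (h' : a + b = c) (i : Fin m)
      (σ : Perm (Fin m)) (τ : Perm (Fin n)) (x : Term K G m a) (y : Term K G n b) :
      Rel R (.comp h h' i (x.act σ) (y.act τ))
        (.act (blockPerm h i σ τ) (.comp h h' (σ i) x y))

section Leibniz

variable {K : Type u} [Field K]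

theorem ksign_add (a b : ℤ) : ksign K (a + b) = ksign K a * ksign K b := by
  simp [ksign, Int.negOnePow_add]

theorem ksign_zero : ksign K 0 = 1 := by simp [ksign]

theorem ksign_mul_self (a : ℤ) : ksign K a * ksign K a = 1 := by
  rw [← ksign_add, ksign, Int.negOnePow_even _ ⟨a, rfl⟩]; simp

theorem ksign_sub_one (a : ℤ) : ksign K (a - 1) = - ksign K a := by
  simp [ksign, Int.negOnePow_sub]

/-- `x' ∘_i y + (-1)^{|x|} x ∘_i y'`, the value of a derivation on `x ∘_i y` if `x'` and `y'` are its
values on `x` and `y`. -/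
def GradedOperad.leib (P : GradedOperad K) {m n r : ℕ} {a b c : ℤ} (h : m + n = r + 1)
    (h' : a + b = c) (i : Fin m) (x : P.obj m a) (x' : P.obj m (a - 1)) (y : P.obj n b)
    (y' : P.obj n (b - 1)) : P.obj r (c - 1) :=
  P.comp h (show a - 1 + b = c - 1 by omega) i x' y +
    ksign K a • P.comp h (show a + (b - 1) = c - 1 by omega) i x y'

variable (P : GradedOperad K)

theorem GradedOperad.leib_assoc {l m n s t v : ℕ} {a b c e f g : ℤ} (h₁ : l + m = s + 1)
    (h₂ : s + n = t + 1) (h₃ : m + n = v + 1) (h₄ : l + v = t + 1) (k₁ : a + b = e) (k₂ : e + c = f)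
    (k₃ : b + c = g) (k₄ : a + g = f) (i : Fin l) (j : Fin m) (k : Fin s) (hk : (k : ℕ) = i + j)
    (x : P.obj l a) (y : P.obj m b) (z : P.obj n c) (x' : P.obj l (a - 1)) (y' : P.obj m (b - 1))
    (z' : P.obj n (c - 1)) :
    P.leib h₂ k₂ k (P.comp h₁ k₁ i x y) (P.leib h₁ k₁ i x x' y y') z z' =
      P.leib h₄ k₄ i x x' (P.comp h₃ k₃ j y z) (P.leib h₃ k₃ j y y' z z') := by
  simp only [leib, map_add, map_smul, LinearMap.add_apply, LinearMap.smul_apply, smul_add]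
  rw [P.comp_assoc h₁ _ h₃ h₄ _ _ k₃ (by omega) i j k hk,
    P.comp_assoc h₁ _ h₃ h₄ _ _ (show b - 1 + c = g - 1 by omega) (by omega) i j k hk,
    P.comp_assoc h₁ _ h₃ h₄ _ _ (show b + (c - 1) = g - 1 by omega) (by omega) i j k hk,
    show ksign K e = ksign K a * ksign K b by rw [← k₁, ksign_add], mul_smul, add_assoc]

theorem GradedOperad.leib_comm {l m n s t v : ℕ} {a b c e f g : ℤ} (h₁ : l + m = s + 1)
    (h₂ : s + n = t + 1) (h₃ : l + n = v + 1) (h₄ : v + m = t + 1) (k₁ : a + b = e) (k₂ : e + c = f)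
    (k₃ : a + c = g) (k₄ : g + b = f) (i k : Fin l) (i' : Fin v) (k' : Fin s) (hik : i < k)
    (hi : (i' : ℕ) = i) (hk : (k' : ℕ) + 1 = k + m)
    (x : P.obj l a) (y : P.obj m b) (z : P.obj n c) (x' : P.obj l (a - 1)) (y' : P.obj m (b - 1))
    (z' : P.obj n (c - 1)) :
    P.leib h₂ k₂ k' (P.comp h₁ k₁ i x y) (P.leib h₁ k₁ i x x' y y') z z' =
      ksign K (b * c) • P.leib h₄ k₄ i' (P.comp h₃ k₃ k x z) (P.leib h₃ k₃ k x x' z z') y y' := by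
  simp only [leib, map_add, map_smul, LinearMap.add_apply, LinearMap.smul_apply, smul_add]
  rw [P.comp_comm h₁ _ h₃ h₄ _ _ (show a - 1 + c = g - 1 by omega) (by omega) i k i' k' hik hi hk x',
    P.comp_comm h₁ _ h₃ h₄ _ _ k₃ (by omega) i k i' k' hik hi hk _ y',
    P.comp_comm h₁ _ h₃ h₄ _ _ (show a + (c - 1) = g - 1 by omega) (by omega) i k i' k' hik hi hk
      _ _ z']
  have s₁ : ksign K ((b - 1) * c) = ksign K (b * c) * ksign K c := by
    rw [← ksign_add]
    have : b * c + c = (b - 1) * c + (c + c) := by ring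
    rw [this, ksign_add _ (c + c), ksign_add c c, ksign_mul_self, mul_one]
  have s₂ : ksign K (b * (c - 1)) = ksign K (b * c) * ksign K b := by
    rw [← ksign_add]
    have : b * c + b = b * (c - 1) + (b + b) := by ring
    rw [this, ksign_add _ (b + b), ksign_add b b, ksign_mul_self, mul_one]
  have s₃ : ksign K e * (ksign K (b * c) * ksign K b) = ksign K (b * c) * ksign K a := by
    rw [← k₁, ksign_add]
    linear_combination (ksign K (b * c) * ksign K a) * ksign_mul_self (K := K) b
  have s₄ : ksign K a * (ksign K (b * c) * ksign K c) = ksign K (b * c) * ksign K g := by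
    rw [← k₃, ksign_add]; ring
  simp only [s₁, s₂, smul_smul, s₃, s₄]
  abel

theorem GradedOperad.leib_act {m n r : ℕ} {a b c : ℤ} (h : m + n = r + 1) (h' : a + b = c)
    (i : Fin m) (σ : Perm (Fin m)) (τ : Perm (Fin n)) (x : P.obj m a) (x' : P.obj m (a - 1))
    (y : P.obj n b) (y' : P.obj n (b - 1)) :
    P.leib h h' i (P.act σ x) (P.act σ x') (P.act τ y) (P.act τ y') =
      P.act (blockPerm h i σ τ) (P.leib h h' (σ i) x x' y y') := by
  simp only [leib, map_add, map_smul, P.comp_act]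

theorem GradedOperad.leib_add_left {m n r : ℕ} {a b c : ℤ} (h : m + n = r + 1) (h' : a + b = c)
    (i : Fin m) (x y : P.obj m a) (x' y' : P.obj m (a - 1)) (z : P.obj n b) (z' : P.obj n (b - 1)) :
    P.leib h h' i (x + y) (x' + y') z z' = P.leib h h' i x x' z z' + P.leib h h' i y y' z z' := by
  simp only [leib, map_add, LinearMap.add_apply, smul_add]
  abel

theorem GradedOperad.leib_add_right {m n r : ℕ} {a b c : ℤ} (h : m + n = r + 1) (h' : a + b = c)
    (i : Fin m) (x : P.obj m a) (x' : P.obj m (a - 1)) (y z : P.obj n b) (y' z' : P.obj n (b - 1)) :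
    P.leib h h' i x x' (y + z) (y' + z') = P.leib h h' i x x' y y' + P.leib h h' i x x' z z' := by
  simp only [leib, map_add, smul_add]
  abel

theorem GradedOperad.leib_smul_left {m n r : ℕ} {a b c : ℤ} (h : m + n = r + 1) (h' : a + b = c)
    (i : Fin m) (k : K) (x : P.obj m a) (x' : P.obj m (a - 1)) (z : P.obj n b)
    (z' : P.obj n (b - 1)) :
    P.leib h h' i (k • x) (k • x') z z' = k • P.leib h h' i x x' z z' := by
  simp only [leib, map_smul, LinearMap.smul_apply, smul_add, smul_comm k]

theorem GradedOperad.leib_smul_right {m n r : ℕ} {a b c : ℤ} (h : m + n = r + 1) (h' : a + b = c)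
    (i : Fin m) (k : K) (x : P.obj m a) (x' : P.obj m (a - 1)) (z : P.obj n b)
    (z' : P.obj n (b - 1)) :
    P.leib h h' i x x' (k • z) (k • z') = k • P.leib h h' i x x' z z' := by
  simp only [leib, map_smul, smul_add, smul_comm k]

theorem GradedOperad.leib_one_left {n : ℕ} {a : ℤ} (h : 1 + n = n + 1) (h' : 0 + a = a) (i : Fin 1)
    (x : P.obj n a) (x' : P.obj n (a - 1)) : P.leib h h' i P.one 0 x x' = x' := by
  simp only [leib, map_zero, LinearMap.zero_apply, zero_add, ksign_zero, one_smul, P.one_comp]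

theorem GradedOperad.leib_one_right {n : ℕ} {a : ℤ} (h : n + 1 = n + 1) (h' : a + 0 = a) (i : Fin n)
    (x : P.obj n a) (x' : P.obj n (a - 1)) : P.leib h h' i x x' P.one 0 = x' := by
  simp only [leib, map_zero, add_zero, smul_zero, P.comp_one]

variable {P}

theorem Derivation.map_one (d : Derivation P) : d.toFun P.one = 0 := by
  have h := d.map_comp (show 1 + 1 = 1 + 1 from rfl) (show (0 : ℤ) + 0 = 0 from rfl) 0 P.one P.one
  have h1 := P.one_comp (show 1 + 1 = 1 + 1 from rfl) (zero_add _) 0 (d.toFun P.one)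
  have h2 := P.comp_one (show 1 + 1 = 1 + 1 from rfl) (add_zero _) 0 (d.toFun P.one)
  rw [P.comp_one, ksign_zero, one_smul, h1] at h
  erw [h2] at h
  simpa using h

/-- A derivation squares to zero on a composite if it does on the factors. -/
theorem Derivation.sq_comp (d : Derivation P) {m n r : ℕ} {a b c : ℤ}
    (h : m + n = r + 1) (h' : a + b = c) (i : Fin m) (x : P.obj m a) (y : P.obj n b)
    (hx : d.toFun (d.toFun x) = 0) (hy : d.toFun (d.toFun y) = 0) :
    d.toFun (d.toFun (P.comp h h' i x y)) = 0 := by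
  rw [d.map_comp, map_add, map_smul, d.map_comp, d.map_comp, hx, hy]
  simp [ksign_sub_one]

end Leibniz

section Presented

variable {K : Type u} [Field K] {G : ℕ → ℤ → Type u}
  (R : ∀ n a, Term K G n a → Term K G n a → Prop)

/-- The setoid of the congruence generated by `R`. -/
def relSetoid (n : ℕ) (a : ℤ) : Setoid (Term K G n a) where
  r := Rel R
  iseqv := ⟨Rel.refl, Rel.symm, Rel.trans⟩

/-- The operations of arity `n` and degree `a` of the operad with generators `G` and relations
`R`. -/
def PObj (n : ℕ) (a : ℤ) : Type u := Quotient (relSetoid R n a)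

variable {R}

/-- The class of a formal expression. -/
def PObj.mk {n : ℕ} {a : ℤ} (x : Term K G n a) : PObj R n a := Quotient.mk (relSetoid R n a) x

theorem PObj.sound {n : ℕ} {a : ℤ} {x y : Term K G n a} (h : Rel R x y) :
    (PObj.mk x : PObj R n a) = PObj.mk y := Quotient.sound h

theorem PObj.ind {n : ℕ} {a : ℤ} {p : PObj R n a → Prop} (h : ∀ x, p (PObj.mk x)) (x) : p x :=
  Quotient.ind h x

instance PObj.instAdd (n : ℕ) (a : ℤ) : Add (PObj R n a) where
  add := Quotient.map₂ Term.add fun _ _ h _ _ h' => Rel.add_congr h h'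

instance PObj.instZero (n : ℕ) (a : ℤ) : Zero (PObj R n a) where
  zero := PObj.mk .zero

instance PObj.instNeg (n : ℕ) (a : ℤ) : Neg (PObj R n a) where
  neg := Quotient.map (Term.smul (-1)) fun _ _ h => Rel.smul_congr _ h

instance PObj.instAddCommGroup (n : ℕ) (a : ℤ) : AddCommGroup (PObj R n a) where
  add_assoc := by
    rintro ⟨x⟩ ⟨y⟩ ⟨z⟩; exact PObj.sound (Rel.add_assoc x y z)
  add_comm := by
    rintro ⟨x⟩ ⟨y⟩; exact PObj.sound (Rel.add_comm x y)
  zero_add := by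
    rintro ⟨x⟩; exact PObj.sound (Rel.zero_add x)
  add_zero := by
    rintro ⟨x⟩; exact PObj.sound ((Rel.add_comm x _).trans (Rel.zero_add x))
  neg_add_cancel := by
    rintro ⟨x⟩
    refine PObj.sound (((Rel.add_congr (Rel.refl _) (Rel.one_smul x).symm).trans
      (Rel.add_smul (-1) 1 x).symm).trans ?_)
    rw [neg_add_cancel]
    exact Rel.zero_smul x
  nsmul := nsmulRec
  zsmul := zsmulRec

instance PObj.instModule (n : ℕ) (a : ℤ) : Module K (PObj R n a) where
  smul k := Quotient.map (Term.smul k) fun _ _ h => Rel.smul_congr _ h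
  one_smul := by
    rintro ⟨x⟩; exact PObj.sound (Rel.one_smul x)
  mul_smul := by
    rintro k l ⟨x⟩; exact PObj.sound (Rel.mul_smul k l x)
  smul_add := by
    rintro k ⟨x⟩ ⟨y⟩; exact PObj.sound (Rel.smul_add k x y)
  add_smul := by
    rintro k l ⟨x⟩; exact PObj.sound (Rel.add_smul k l x)
  zero_smul := by
    rintro ⟨x⟩; exact PObj.sound (Rel.zero_smul x)
  smul_zero := by
    intro k
    refine PObj.sound ?_
    have h := Rel.zero_smul (R := R) (Term.zero (K := K) (G := G) (n := n) (a := a))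
    refine (Rel.smul_congr k h.symm).trans ((Rel.mul_smul k 0 _).symm.trans ?_)
    rw [mul_zero]
    exact h

variable (R)

/-- The graded operad with generators `G` and relations `R`. -/
def presented : GradedOperad K where
  obj := PObj R
  act σ :=
    { toFun := Quotient.map (Term.act σ) fun _ _ h => Rel.act_congr _ h
      map_add' := by rintro ⟨x⟩ ⟨y⟩; exact PObj.sound (Rel.act_add σ x y)
      map_smul' := by rintro k ⟨x⟩; exact PObj.sound (Rel.act_smul σ k x) }
  one := PObj.mk .one
  comp h h' i := LinearMap.mk₂ K
    (Quotient.map₂ (Term.comp h h' i) fun _ _ e _ _ e' => Rel.comp_congr _ _ _ e e')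
    (by rintro ⟨x⟩ ⟨y⟩ ⟨z⟩; exact PObj.sound (Rel.add_comp h h' i x y z))
    (by rintro k ⟨x⟩ ⟨y⟩; exact PObj.sound (Rel.smul_comp h h' i k x y))
    (by rintro ⟨x⟩ ⟨y⟩ ⟨z⟩; exact PObj.sound (Rel.comp_add h h' i x y z))
    (by rintro k ⟨x⟩ ⟨y⟩; exact PObj.sound (Rel.comp_smul h h' i k x y))
  act_one := by rintro n a ⟨x⟩; exact PObj.sound (Rel.act_one x)
  act_mul := by rintro n a σ τ ⟨x⟩; exact PObj.sound (Rel.act_mul σ τ x)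
  one_comp := by rintro n a h h' i ⟨x⟩; exact PObj.sound (Rel.one_comp h h' i x)
  comp_one := by rintro n a h h' i ⟨x⟩; exact PObj.sound (Rel.comp_one h h' i x)
  comp_assoc := by
    rintro l m n s t v a b c e f g h₁ h₂ h₃ h₄ k₁ k₂ k₃ k₄ i j k hk ⟨x⟩ ⟨y⟩ ⟨z⟩
    exact PObj.sound (Rel.comp_assoc h₁ h₂ h₃ h₄ k₁ k₂ k₃ k₄ i j k hk x y z)
  comp_comm := by
    rintro l m n s t v a b c e f g h₁ h₂ h₃ h₄ k₁ k₂ k₃ k₄ i k i' k' hik hi hk ⟨x⟩ ⟨y⟩ ⟨z⟩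
    exact PObj.sound (Rel.comp_comm h₁ h₂ h₃ h₄ k₁ k₂ k₃ k₄ i k i' k' hik hi hk x y z)
  comp_act := by
    rintro m n r a b c h h' i σ τ ⟨x⟩ ⟨y⟩
    exact PObj.sound (Rel.comp_act h h' i σ τ x y)

variable {R}

/-- The class of a formal expression in the operad with generators `G` and relations `R`. -/
def cls {n : ℕ} {a : ℤ} (x : Term K G n a) : (presented R).obj n a := PObj.mk x

/-- The class of a generator. -/
def gen {n : ℕ} {a : ℤ} (g : G n a) : (presented R).obj n a := cls (.gen g)

theorem cls_sound {n : ℕ} {a : ℤ} {x y : Term K G n a} (h : Rel R x y) :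
    (cls x : (presented R).obj n a) = cls y := PObj.sound h

/-- The value on a formal expression of the derivation that extends given values on generators. -/
def Term.der (D : ∀ n a, G n a → (presented R).obj n (a - 1)) :
    ∀ {n : ℕ} {a : ℤ}, Term K G n a → (presented R).obj n (a - 1)
  | _, _, .gen g => D _ _ g
  | _, _, .zero => 0
  | _, _, .add x y => x.der D + y.der D
  | _, _, .smul k x => k • x.der D
  | _, _, .act σ x => (presented R).act σ (x.der D)
  | _, _, .one => 0
  | _, _, .comp h h' i x y => (presented R).leib h h' i (cls x) (x.der D) (cls y) (y.der D)

theorem Term.der_rel (D : ∀ n a, G n a → (presented R).obj n (a - 1))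
    (hD : ∀ n a x y, R n a x y → x.der D = y.der D)
    {n : ℕ} {a : ℤ} {x y : Term K G n a} (h : Rel R x y) : x.der D = y.der D := by
  induction h with
  | of h => exact hD _ _ _ _ h
  | refl x => rfl
  | symm _ ih => exact ih.symm
  | trans _ _ ih₁ ih₂ => exact ih₁.trans ih₂
  | add_congr _ _ ih₁ ih₂ => simp only [Term.der, ih₁, ih₂]
  | smul_congr k _ ih => simp only [Term.der, ih]
  | act_congr σ _ ih => simp only [Term.der, ih]
  | comp_congr h h' i e₁ e₂ ih₁ ih₂ =>
      simp only [Term.der, ih₁, ih₂, cls_sound e₁, cls_sound e₂]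
  | add_assoc x y z => exact add_assoc _ _ _
  | add_comm x y => exact add_comm _ _
  | zero_add x => exact zero_add _
  | one_smul x => exact one_smul _ _
  | zero_smul x => exact zero_smul _ _
  | mul_smul k l x => exact mul_smul _ _ _
  | add_smul k l x => exact add_smul _ _ _
  | smul_add k x y => exact smul_add _ _ _
  | act_add σ x y => exact map_add _ _ _
  | act_smul σ k x => exact map_smul _ _ _
  | add_comp h h' i x y z => exact (presented R).leib_add_left h h' i (cls x) (cls y) _ _ _ _
  | smul_comp h h' i k x z => exact (presented R).leib_smul_left h h' i k (cls x) _ _ _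
  | comp_add h h' i x y z => exact (presented R).leib_add_right h h' i _ _ (cls y) (cls z) _ _
  | comp_smul h h' i k x z => exact (presented R).leib_smul_right h h' i k _ _ (cls z) _
  | act_one x => exact (presented R).act_one _
  | act_mul σ τ x => exact (presented R).act_mul _ _ _
  | one_comp h h' i x => exact (presented R).leib_one_left h h' i _ _
  | comp_one h h' i x => exact (presented R).leib_one_right h h' i _ _
  | comp_assoc h₁ h₂ h₃ h₄ k₁ k₂ k₃ k₄ i j k hk x y z =>
      exact (presented R).leib_assoc h₁ h₂ h₃ h₄ k₁ k₂ k₃ k₄ i j k hk _ _ _ _ _ _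
  | comp_comm h₁ h₂ h₃ h₄ k₁ k₂ k₃ k₄ i k i' k' hik hi hk x y z =>
      exact (presented R).leib_comm h₁ h₂ h₃ h₄ k₁ k₂ k₃ k₄ i k i' k' hik hi hk _ _ _ _ _ _
  | comp_act h h' i σ τ x y => exact (presented R).leib_act h h' i σ τ (cls x) _ (cls y) _

/-- The derivation of `presented R` with given values on generators. -/
def presentedDer (D : ∀ n a, G n a → (presented R).obj n (a - 1))
    (hD : ∀ n a x y, R n a x y → x.der D = y.der D) : Derivation (presented R) where
  toFun :=
    { toFun := Quotient.lift (Term.der D) fun _ _ h => Term.der_rel D hD h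
      map_add' := by rintro ⟨x⟩ ⟨y⟩; rfl
      map_smul' := by rintro k ⟨x⟩; rfl }
  map_act := by rintro n a σ ⟨x⟩; rfl
  map_comp := by rintro m n r a b c h h' i ⟨x⟩ ⟨y⟩; rfl

/-- A derivation that squares to zero on generators squares to zero. -/
theorem Derivation.sq_eq_zero (d : Derivation (presented R))
    (hd : ∀ n a (g : G n a), d.toFun (d.toFun (gen g : (presented R).obj n a)) = 0)
    {n : ℕ} {a : ℤ} (x : (presented R).obj n a) : d.toFun (d.toFun x) = 0 := by
  suffices H : ∀ {n : ℕ} {a : ℤ} (w : Term K G n a),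
      d.toFun (d.toFun (cls w : (presented R).obj n a)) = 0 by
    obtain ⟨w⟩ := x
    exact H w
  intro n a w
  induction w with
  | gen g => exact hd _ _ g
  | zero => exact (congrArg _ (map_zero d.toFun)).trans (map_zero _)
  | add x y hx hy =>
      have e : (cls (x.add y) : (presented R).obj _ _) = cls x + cls y := rfl
      rw [e, map_add, map_add, hx, hy, add_zero]
  | smul k x hx =>
      have e : (cls (x.smul k) : (presented R).obj _ _) = k • cls x := rfl
      rw [e, map_smul, map_smul, hx, smul_zero]
  | act σ x hx =>
      have e : (cls (x.act σ) : (presented R).obj _ _) = (presented R).act σ (cls x) := rfl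
      rw [e, d.map_act, d.map_act, hx, map_zero]
  | one =>
      have e : (cls .one : (presented R).obj _ _) = (presented R).one := rfl
      rw [e, d.map_one, map_zero]
  | comp h h' i x y hx hy => exact d.sq_comp h h' i _ _ hx hy

/-- The dg operad whose underlying graded operad has generators `G` and relations `R`, with the
differential that takes the values `D` on the generators. -/
def presentedDG (R : ∀ n a, Term K G n a → Term K G n a → Prop)
    (D : ∀ n a, G n a → (presented R).obj n (a - 1))
    (hD : ∀ n a x y, R n a x y → x.der D = y.der D)
    (hDD : ∀ n a (g : G n a), (presentedDer D hD).toFun (D n a g) = 0) : DGOperad K where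
  op := presented R
  d := presentedDer D hD
  d_d := (presentedDer D hD).sq_eq_zero hDD

end Presented

section Constructions

variable (K : Type u) [Field K]

/-- The generators of `T`: `α` in degree `0` and `κ` in degree `-1`, both of arity `0`. -/
inductive TGen : ℕ → ℤ → Type u
  | alpha : TGen 0 0
  | kappa : TGen 0 (-1)

/-- No relations. -/
def noRel (G : ℕ → ℤ → Type u) (n : ℕ) (a : ℤ) (_ _ : Term K G n a) : Prop := False

/-- The differential of `T` on generators: `d α = κ` and `d κ = 0`. -/
def dT : ∀ n a, TGen.{u} n a → (presented (noRel K TGen)).obj n (a - 1)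
  | _, _, .alpha => gen (R := noRel K TGen) TGen.kappa
  | _, _, .kappa => 0

/-- The dg operad `T`, freely generated by `α` and `κ`, with `d α = κ`. -/
def T : DGOperad K :=
  presentedDG (noRel K TGen) (dT K) (fun _ _ _ _ h => h.elim) (by
    intro n a g
    cases g with
    | alpha => rfl
    | kappa => exact map_zero _)

variable {K}

/-- The relations of the coproduct: the operations of `P` and of `Q` are the generators, and linear
combinations, permutations, the identity and composites are those of `P` and of `Q`. -/
inductive CoprodRel (P Q : GradedOperad K) : ∀ n a,
    Term K (fun n a => P.obj n a ⊕ Q.obj n a) n a →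
    Term K (fun n a => P.obj n a ⊕ Q.obj n a) n a → Prop
  | inl_add {n : ℕ} {a : ℤ} (x y : P.obj n a) :
      CoprodRel P Q _ _ (.gen (.inl (x + y))) (.add (.gen (.inl x)) (.gen (.inl y)))
  | inl_smul {n : ℕ} {a : ℤ} (k : K) (x : P.obj n a) :
      CoprodRel P Q _ _ (.gen (.inl (k • x))) (.smul k (.gen (.inl x)))
  | inl_act {n : ℕ} {a : ℤ} (σ : Perm (Fin n)) (x : P.obj n a) :
      CoprodRel P Q _ _ (.gen (.inl (P.act σ x))) (.act σ (.gen (.inl x)))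
  | inl_one : CoprodRel P Q _ _ (.gen (.inl P.one)) .one
  | inl_comp {m n r : ℕ} {a b c : ℤ} (h : m + n = r + 1) (h' : a + b = c) (i : Fin m)
      (x : P.obj m a) (y : P.obj n b) :
      CoprodRel P Q _ _ (.gen (.inl (P.comp h h' i x y)))
        (.comp h h' i (.gen (.inl x)) (.gen (.inl y)))
  | inr_add {n : ℕ} {a : ℤ} (x y : Q.obj n a) :
      CoprodRel P Q _ _ (.gen (.inr (x + y))) (.add (.gen (.inr x)) (.gen (.inr y)))
  | inr_smul {n : ℕ} {a : ℤ} (k : K) (x : Q.obj n a) :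
      CoprodRel P Q _ _ (.gen (.inr (k • x))) (.smul k (.gen (.inr x)))
  | inr_act {n : ℕ} {a : ℤ} (σ : Perm (Fin n)) (x : Q.obj n a) :
      CoprodRel P Q _ _ (.gen (.inr (Q.act σ x))) (.act σ (.gen (.inr x)))
  | inr_one : CoprodRel P Q _ _ (.gen (.inr Q.one)) .one
  | inr_comp {m n r : ℕ} {a b c : ℤ} (h : m + n = r + 1) (h' : a + b = c) (i : Fin m)
      (x : Q.obj m a) (y : Q.obj n b) :
      CoprodRel P Q _ _ (.gen (.inr (Q.comp h h' i x y)))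
        (.comp h h' i (.gen (.inr x)) (.gen (.inr y)))

/-- The inclusion of the operations of `P` in the coproduct of `P` and `Q`. -/
def inl {P Q : GradedOperad K} {n : ℕ} {a : ℤ} :
    P.obj n a →ₗ[K] (presented (CoprodRel P Q)).obj n a where
  toFun x := gen (R := CoprodRel P Q) (.inl x)
  map_add' x y := cls_sound (.of (.inl_add x y))
  map_smul' k x := cls_sound (.of (.inl_smul k x))

/-- The inclusion of the operations of `Q` in the coproduct of `P` and `Q`. -/
def inr {P Q : GradedOperad K} {n : ℕ} {a : ℤ} :
    Q.obj n a →ₗ[K] (presented (CoprodRel P Q)).obj n a where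
  toFun x := gen (R := CoprodRel P Q) (.inr x)
  map_add' x y := cls_sound (.of (.inr_add x y))
  map_smul' k x := cls_sound (.of (.inr_smul k x))

/-- The differential of the coproduct on the operations of `P` and of `Q`. -/
def dCoprod (P Q : DGOperad K) : ∀ n a, P.op.obj n a ⊕ Q.op.obj n a →
    (presented (CoprodRel P.op Q.op)).obj n (a - 1)
  | _, _, .inl x => inl (P.d.toFun x)
  | _, _, .inr x => inr (Q.d.toFun x)

theorem dCoprod_rel (P Q : DGOperad K) (n : ℕ) (a : ℤ)
    (x y : Term K (fun n a => P.op.obj n a ⊕ Q.op.obj n a) n a) (h : CoprodRel P.op Q.op n a x y) :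
    x.der (dCoprod P Q) = y.der (dCoprod P Q) := by
  cases h with
  | inl_add x y => exact (congrArg inl (map_add P.d.toFun x y)).trans (map_add inl _ _)
  | inl_smul k x => exact (congrArg inl (map_smul P.d.toFun k x)).trans (map_smul inl _ _)
  | inl_act σ x =>
      exact (congrArg inl (P.d.map_act σ x)).trans (cls_sound (.of (.inl_act σ (P.d.toFun x))))
  | inl_one => exact (congrArg inl P.d.map_one).trans (map_zero inl)
  | inl_comp h h' i x y =>
      refine (congrArg inl (P.d.map_comp h h' i x y)).trans ((map_add inl _ _).trans ?_)
      rw [map_smul]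
      exact congrArg₂ (fun u v => u + ksign K _ • v)
        (cls_sound (.of (.inl_comp h _ i (P.d.toFun x) y)))
        (cls_sound (.of (.inl_comp h _ i x (P.d.toFun y))))
  | inr_add x y => exact (congrArg inr (map_add Q.d.toFun x y)).trans (map_add inr _ _)
  | inr_smul k x => exact (congrArg inr (map_smul Q.d.toFun k x)).trans (map_smul inr _ _)
  | inr_act σ x =>
      exact (congrArg inr (Q.d.map_act σ x)).trans (cls_sound (.of (.inr_act σ (Q.d.toFun x))))
  | inr_one => exact (congrArg inr Q.d.map_one).trans (map_zero inr)
  | inr_comp h h' i x y =>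
      refine (congrArg inr (Q.d.map_comp h h' i x y)).trans ((map_add inr _ _).trans ?_)
      rw [map_smul]
      exact congrArg₂ (fun u v => u + ksign K _ • v)
        (cls_sound (.of (.inr_comp h _ i (Q.d.toFun x) y)))
        (cls_sound (.of (.inr_comp h _ i x (Q.d.toFun y))))

/-- The coproduct `P ∨ Q` of dg operads. -/
def coprod (P Q : DGOperad K) : DGOperad K :=
  presentedDG (CoprodRel P.op Q.op) (dCoprod P Q) (dCoprod_rel P Q) (by
    rintro n a (x | x)
    · exact (congrArg inl (P.d_d x)).trans (map_zero inl)
    · exact (congrArg inr (Q.d_d x)).trans (map_zero inr))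

/-- A decreasing multiplicative filtration on a dg operad, which the differential respects up to a
shift by one. -/
structure Filtration (P : DGOperad K) where
  F : ℕ → ∀ n a, Submodule K (P.op.obj n a)
  zero_eq : ∀ n a, F 0 n a = ⊤
  anti : ∀ k n a, F (k + 1) n a ≤ F k n a
  act_mem : ∀ {k n : ℕ} {a : ℤ} (σ : Perm (Fin n)) {x : P.op.obj n a}, x ∈ F k n a →
    P.op.act σ x ∈ F k n a
  comp_mem : ∀ {k l m n r : ℕ} {a b c : ℤ} (h : m + n = r + 1) (h' : a + b = c) (i : Fin m)
    {x : P.op.obj m a} {y : P.op.obj n b}, x ∈ F k m a → y ∈ F l n b →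
    P.op.comp h h' i x y ∈ F (k + l) r c
  d_mem : ∀ {k n : ℕ} {a : ℤ} {x : P.op.obj n a}, x ∈ F (k + 1) n a → P.d.toFun x ∈ F k n (a - 1)

namespace Filtration

variable {P : DGOperad K} (F : Filtration P)

/-- The completion `lim_k P / F_k` in arity `n` and degree `a`. -/
def completion (n : ℕ) (a : ℤ) : Submodule K (∀ k, P.op.obj n a ⧸ F.F k n a) where
  carrier := {x | ∀ k, Submodule.factor (F.anti k n a) (x (k + 1)) = x k}
  add_mem' hx hy k := by rw [Pi.add_apply, map_add, hx, hy, Pi.add_apply]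
  zero_mem' k := map_zero _
  smul_mem' c x hx k := by rw [Pi.smul_apply, map_smul, hx, Pi.smul_apply]

/-- The action of a permutation on `P / F_k`. -/
def qAct (k : ℕ) {n : ℕ} {a : ℤ} (σ : Perm (Fin n)) :
    (P.op.obj n a ⧸ F.F k n a) →ₗ[K] (P.op.obj n a ⧸ F.F k n a) :=
  Submodule.mapQ _ _ (P.op.act σ) fun _ hx => F.act_mem σ hx

/-- The partial composition on `P / F_k`. -/
def qComp (k : ℕ) {m n r : ℕ} {a b c : ℤ} (h : m + n = r + 1) (h' : a + b = c) (i : Fin m) :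
    (P.op.obj m a ⧸ F.F k m a) →ₗ[K] (P.op.obj n b ⧸ F.F k n b) →ₗ[K] (P.op.obj r c ⧸ F.F k r c) :=
  Submodule.liftQ _
    (LinearMap.mk₂ K
      (fun x => Submodule.mapQ (F.F k n b) (F.F k r c) (P.op.comp h h' i x) fun y hy => by
        have := F.comp_mem h h' i (k := 0) (x := x) (by rw [F.zero_eq]; trivial) hy
        rwa [zero_add] at this)
      (by rintro x x' ⟨y⟩; exact congrArg (Submodule.Quotient.mk) (by simp))
      (by rintro k x ⟨y⟩; exact congrArg (Submodule.Quotient.mk) (by simp))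
      (by intros; simp) (by intros; simp))
    fun x hx => by
      ext y
      simpa [Submodule.Quotient.mk_eq_zero] using
        F.comp_mem h h' i (l := 0) (y := y) hx (by rw [F.zero_eq]; trivial)

/-- The differential `P / F_{k+1} → P / F_k`. -/
def qD (k : ℕ) {n : ℕ} {a : ℤ} :
    (P.op.obj n a ⧸ F.F (k + 1) n a) →ₗ[K] (P.op.obj n (a - 1) ⧸ F.F k n (a - 1)) :=
  Submodule.mapQ _ _ P.d.toFun fun _ hx => F.d_mem hx

theorem completion_ext {n : ℕ} {a : ℤ} {x y : F.completion n a} (h : ∀ k, x.1 k = y.1 k) : x = y :=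
  Subtype.ext (funext h)

theorem exists_rep {n : ℕ} {a : ℤ} (x : F.completion n a) (k : ℕ) :
    ∃ w, (Submodule.Quotient.mk w : P.op.obj n a ⧸ F.F k n a) = x.1 k :=
  Submodule.Quotient.mk_surjective _ _

/-- Two compatible components of an element of the completion have a common representative. -/
theorem exists_rep_succ {n : ℕ} {a : ℤ} (x : F.completion n a) (k : ℕ) :
    ∃ w, (Submodule.Quotient.mk w : P.op.obj n a ⧸ F.F (k + 1) n a) = x.1 (k + 1) ∧
      (Submodule.Quotient.mk w : P.op.obj n a ⧸ F.F k n a) = x.1 k := by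
  obtain ⟨w, hw⟩ := F.exists_rep x (k + 1)
  refine ⟨w, hw, ?_⟩
  rw [← x.2 k, ← hw]
  rfl

/-- The action of a permutation on the completion. -/
def cAct {n : ℕ} {a : ℤ} (σ : Perm (Fin n)) : F.completion n a →ₗ[K] F.completion n a where
  toFun x := ⟨fun k => F.qAct k σ (x.1 k), fun k => by
    obtain ⟨w, h₁, h₂⟩ := F.exists_rep_succ x k
    dsimp only
    rw [← h₁, ← h₂]; rfl⟩
  map_add' x y := F.completion_ext fun k => map_add (F.qAct k σ) _ _
  map_smul' c x := F.completion_ext fun k => map_smul (F.qAct k σ) _ _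

/-- The partial composition on the completion. -/
def cComp {m n r : ℕ} {a b c : ℤ} (h : m + n = r + 1) (h' : a + b = c) (i : Fin m) :
    F.completion m a →ₗ[K] F.completion n b →ₗ[K] F.completion r c :=
  LinearMap.mk₂ K
    (fun x y => ⟨fun k => F.qComp k h h' i (x.1 k) (y.1 k), fun k => by
      obtain ⟨w, h₁, h₂⟩ := F.exists_rep_succ x k
      obtain ⟨v, h₃, h₄⟩ := F.exists_rep_succ y k
      dsimp only
      rw [← h₁, ← h₂, ← h₃, ← h₄]; rfl⟩)
    (fun x x' y => F.completion_ext fun k => LinearMap.map_add₂ (F.qComp k h h' i) _ _ _)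
    (fun c x y => F.completion_ext fun k => LinearMap.map_smul₂ (F.qComp k h h' i) _ _ _)
    (fun x y y' => F.completion_ext fun k => map_add (F.qComp k h h' i (x.1 k)) _ _)
    (fun c x y => F.completion_ext fun k => map_smul (F.qComp k h h' i (x.1 k)) _ _)

/-- The underlying graded operad of the completion, with the operations induced from `P`. -/
def completedOp : GradedOperad K where
  obj n a := F.completion n a
  act := F.cAct
  one := ⟨fun _ => Submodule.Quotient.mk P.op.one, fun _ => rfl⟩
  comp := F.cComp
  act_one x := F.completion_ext fun k => by
    obtain ⟨w, hw⟩ := F.exists_rep x k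
    change F.qAct k 1 (x.1 k) = x.1 k
    rw [← hw]
    exact congrArg Submodule.Quotient.mk (P.op.act_one w)
  act_mul σ τ x := F.completion_ext fun k => by
    obtain ⟨w, hw⟩ := F.exists_rep x k
    change F.qAct k (σ * τ) (x.1 k) = F.qAct k τ (F.qAct k σ (x.1 k))
    rw [← hw]
    exact congrArg Submodule.Quotient.mk (P.op.act_mul σ τ w)
  one_comp h h' i x := F.completion_ext fun k => by
    obtain ⟨w, hw⟩ := F.exists_rep x k
    change F.qComp k h h' i (Submodule.Quotient.mk P.op.one) (x.1 k) = x.1 k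
    rw [← hw]
    exact congrArg Submodule.Quotient.mk (P.op.one_comp h h' i w)
  comp_one h h' i x := F.completion_ext fun k => by
    obtain ⟨w, hw⟩ := F.exists_rep x k
    change F.qComp k h h' i (x.1 k) (Submodule.Quotient.mk P.op.one) = x.1 k
    rw [← hw]
    exact congrArg Submodule.Quotient.mk (P.op.comp_one h h' i w)
  comp_assoc h₁ h₂ h₃ h₄ k₁ k₂ k₃ k₄ i j k hk x y z := F.completion_ext fun q => by
    obtain ⟨u, hu⟩ := F.exists_rep x q
    obtain ⟨v, hv⟩ := F.exists_rep y q
    obtain ⟨w, hw⟩ := F.exists_rep z q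
    change F.qComp q h₂ k₂ k (F.qComp q h₁ k₁ i (x.1 q) (y.1 q)) (z.1 q) =
      F.qComp q h₄ k₄ i (x.1 q) (F.qComp q h₃ k₃ j (y.1 q) (z.1 q))
    rw [← hu, ← hv, ← hw]
    exact congrArg Submodule.Quotient.mk (P.op.comp_assoc h₁ h₂ h₃ h₄ k₁ k₂ k₃ k₄ i j k hk u v w)
  comp_comm h₁ h₂ h₃ h₄ k₁ k₂ k₃ k₄ i k i' k' hik hi hk x y z := F.completion_ext fun q => by
    obtain ⟨u, hu⟩ := F.exists_rep x q
    obtain ⟨v, hv⟩ := F.exists_rep y q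
    obtain ⟨w, hw⟩ := F.exists_rep z q
    change F.qComp q h₂ k₂ k' (F.qComp q h₁ k₁ i (x.1 q) (y.1 q)) (z.1 q) =
      ksign K _ • F.qComp q h₄ k₄ i' (F.qComp q h₃ k₃ k (x.1 q) (z.1 q)) (y.1 q)
    rw [← hu, ← hv, ← hw]
    exact congrArg Submodule.Quotient.mk (P.op.comp_comm h₁ h₂ h₃ h₄ k₁ k₂ k₃ k₄ i k i' k' hik hi hk u v w)
  comp_act h h' i σ τ x y := F.completion_ext fun q => by
    obtain ⟨u, hu⟩ := F.exists_rep x q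
    obtain ⟨v, hv⟩ := F.exists_rep y q
    change F.qComp q h h' i (F.qAct q σ (x.1 q)) (F.qAct q τ (y.1 q)) =
      F.qAct q (blockPerm h i σ τ) (F.qComp q h h' (σ i) (x.1 q) (y.1 q))
    rw [← hu, ← hv]
    exact congrArg Submodule.Quotient.mk (P.op.comp_act h h' i σ τ u v)

/-- The differential of the completion: its component in `P / F_k` is induced by the differential
`P / F_{k+1} → P / F_k`. -/
def completedD : Derivation F.completedOp where
  toFun {n a} :=
    { toFun := fun (x : F.completion n a) =>
        (⟨fun k => F.qD k (x.1 (k + 1)), fun k => by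
          obtain ⟨w, h₁, h₂⟩ := F.exists_rep_succ x (k + 1)
          dsimp only
          rw [← h₁, ← h₂]; rfl⟩ : F.completion n (a - 1))
      map_add' := fun x y => F.completion_ext fun k => map_add (F.qD k) _ _
      map_smul' := fun c x => F.completion_ext fun k => map_smul (F.qD k) _ _ }
  map_act σ x := F.completion_ext fun k => by
    obtain ⟨w, hw⟩ := F.exists_rep x (k + 1)
    change F.qD k (F.qAct (k + 1) σ (x.1 (k + 1))) = F.qAct k σ (F.qD k (x.1 (k + 1)))
    rw [← hw]
    exact congrArg Submodule.Quotient.mk (P.d.map_act σ w)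
  map_comp {m n r a b c} h h' i x y := F.completion_ext fun k => by
    obtain ⟨w, h₁, h₂⟩ := F.exists_rep_succ x k
    obtain ⟨v, h₃, h₄⟩ := F.exists_rep_succ y k
    change F.qD k (F.qComp (k + 1) h h' i (x.1 (k + 1)) (y.1 (k + 1))) =
      F.qComp k h (show a - 1 + b = c - 1 by omega) i (F.qD k (x.1 (k + 1))) (y.1 k) +
      ksign K a • F.qComp k h (show a + (b - 1) = c - 1 by omega) i (x.1 k) (F.qD k (y.1 (k + 1)))
    rw [← h₁, ← h₂, ← h₃, ← h₄]
    exact congrArg Submodule.Quotient.mk (P.d.map_comp h h' i w v)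

/-- The completion of a filtered dg operad. -/
def completed : DGOperad K where
  op := F.completedOp
  d := F.completedD
  d_d x := F.completion_ext fun k => by
    obtain ⟨w, hw⟩ := F.exists_rep x (k + 1 + 1)
    change F.qD k (F.qD (k + 1) (x.1 (k + 1 + 1))) = 0
    rw [← hw]
    exact congrArg Submodule.Quotient.mk (P.d_d w)

/-- The natural map from `P` to its completion. -/
def toCompleted {n : ℕ} {a : ℤ} : P.op.obj n a →ₗ[K] F.completed.op.obj n a where
  toFun x := ⟨fun _ => Submodule.Quotient.mk x, fun _ => rfl⟩
  map_add' _ _ := rfl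
  map_smul' _ _ := rfl

/-- The sum in the completion of a series whose `k`-th term lies in `F_k`: in `P / F_m` it is the
class of the sum of the first `m` terms. -/
def series {n : ℕ} {a : ℤ} (x : ℕ → P.op.obj n a) (hx : ∀ k, x k ∈ F.F k n a) :
    F.completed.op.obj n a :=
  (⟨fun m => Submodule.Quotient.mk (∑ k ∈ Finset.range m, x k), fun m => by
    refine (Submodule.Quotient.eq _).2 ?_
    simpa [Finset.sum_range_succ] using hx m⟩ : F.completion n a)

end Filtration

/-- `IsAlphaPow P k x`: the element `x` of `P ∨ T` is a linear combination of composites in which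
`α` occurs at least `k` times. -/
inductive IsAlphaPow (P : DGOperad K) : ℕ → ∀ {n : ℕ} {a : ℤ}, (coprod P (T K)).op.obj n a → Prop
  | of_zero {n : ℕ} {a : ℤ} (x : (coprod P (T K)).op.obj n a) : IsAlphaPow P 0 x
  | alpha : IsAlphaPow P 1 (inr (gen (R := noRel K TGen) TGen.alpha))
  | of_succ {k n : ℕ} {a : ℤ} {x : (coprod P (T K)).op.obj n a} :
      IsAlphaPow P (k + 1) x → IsAlphaPow P k x
  | zero {k n : ℕ} {a : ℤ} : IsAlphaPow P k (0 : (coprod P (T K)).op.obj n a)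
  | add {k n : ℕ} {a : ℤ} {x y : (coprod P (T K)).op.obj n a} :
      IsAlphaPow P k x → IsAlphaPow P k y → IsAlphaPow P k (x + y)
  | smul {k n : ℕ} {a : ℤ} (c : K) {x : (coprod P (T K)).op.obj n a} :
      IsAlphaPow P k x → IsAlphaPow P k (c • x)
  | act {k n : ℕ} {a : ℤ} (σ : Perm (Fin n)) {x : (coprod P (T K)).op.obj n a} :
      IsAlphaPow P k x → IsAlphaPow P k ((coprod P (T K)).op.act σ x)
  | comp {k l m n r : ℕ} {a b c : ℤ} (h : m + n = r + 1) (h' : a + b = c) (i : Fin m)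
      {x : (coprod P (T K)).op.obj m a} {y : (coprod P (T K)).op.obj n b} :
      IsAlphaPow P k x → IsAlphaPow P l y →
      IsAlphaPow P (k + l) ((coprod P (T K)).op.comp h h' i x y)

theorem IsAlphaPow.mono {P : DGOperad K} {k l n : ℕ} {a : ℤ} {x : (coprod P (T K)).op.obj n a}
    (h : IsAlphaPow P l x) (hkl : k ≤ l) : IsAlphaPow P k x := by
  induction hkl using Nat.decreasingInduction with
  | self => exact h
  | of_succ _ _ ih => exact ih.of_succ

theorem IsAlphaPow.d {P : DGOperad K} {k n : ℕ} {a : ℤ} {x : (coprod P (T K)).op.obj n a}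
    (h : IsAlphaPow P k x) : IsAlphaPow P (k - 1) ((coprod P (T K)).d.toFun x) := by
  induction h with
  | of_zero x => exact .of_zero _
  | alpha => exact .of_zero _
  | of_succ _ ih => exact ih.mono (by omega)
  | zero => rw [map_zero]; exact .zero
  | add _ _ ih₁ ih₂ => rw [map_add]; exact ih₁.add ih₂
  | smul c _ ih => rw [map_smul]; exact ih.smul c
  | act σ _ ih => rw [Derivation.map_act]; exact ih.act σ
  | comp h h' i h₁ h₂ ih₁ ih₂ =>
      rw [Derivation.map_comp]
      exact ((IsAlphaPow.comp h _ i ih₁ h₂).mono (by omega)).add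
        (((IsAlphaPow.comp h _ i h₁ ih₂).mono (by omega)).smul _)

/-- The filtration of `P ∨ T` by the number of `α`. -/
def alphaFiltration (P : DGOperad K) : Filtration (coprod P (T K)) where
  F k _ _ :=
    { carrier := {x | IsAlphaPow P k x}
      add_mem' := .add
      zero_mem' := .zero
      smul_mem' := fun c _ h => .smul c h }
  zero_eq _ _ := eq_top_iff.2 fun x _ => .of_zero x
  anti _ _ _ _ h := .of_succ h
  act_mem σ _ h := .act σ h
  comp_mem h h' i _ _ h₁ h₂ := .comp h h' i h₁ h₂
  d_mem h := IsAlphaPow.d h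

/-- The completed coproduct of `P` and `T`, with respect to the number of `α`. -/
def completedCoprodT (P : DGOperad K) : DGOperad K := (alphaFiltration P).completed

end Constructions

section Unshuffles

/-- The permutations `σ` of `{0, …, n-1}` whose inverses increase on `{0, …, q-1}` and on
`{q, …, n-1}`. As `x^σ` feeds the input `j` into the input `σ j` of `x`, the composites
`(x ∘_0 y)^σ` with `y` of arity `q` and `σ` in this set are those in which any `q` of the inputs are
fed into `y` and the others into `x`, in their order. -/
def unshuffles (q n : ℕ) : Finset (Perm (Fin n)) :=
  open Classical in Finset.univ.filter fun σ =>
    StrictMonoOn σ.symm {i | (i : ℕ) < q} ∧ StrictMonoOn σ.symm {i | q ≤ (i : ℕ)}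

/-- The permutations that preserve the block `{0, …, q-1}`. -/
def blockPerms (q n : ℕ) : Finset (Perm (Fin n)) :=
  Finset.univ.filter fun ρ => ∀ i, (ρ i : ℕ) < q ↔ (i : ℕ) < q

theorem mem_unshuffles {q n : ℕ} {σ : Perm (Fin n)} : σ ∈ unshuffles q n ↔
    StrictMonoOn σ.symm {i | (i : ℕ) < q} ∧ StrictMonoOn σ.symm {i | q ≤ (i : ℕ)} := by
  simp [unshuffles]

theorem mem_blockPerms {q n : ℕ} {ρ : Perm (Fin n)} : ρ ∈ blockPerms q n ↔
    ∀ i, (ρ i : ℕ) < q ↔ (i : ℕ) < q := by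
  simp [blockPerms]

theorem card_blockPerms {p q n : ℕ} (h : p + q = n) :
    (blockPerms q n).card = p.factorial * q.factorial := by
  have e := DomMulAct.stabilizer_card (fun i : Fin n => decide ((i : ℕ) < q))
  have h1 : Fintype.card {i : Fin n // (i : ℕ) < q} = q := by
    rw [Fintype.card_subtype]
    have := Fin.card_filter_val_lt (n := n) (m := q)
    omega
  have h2 : Fintype.card {i : Fin n // ¬ (i : ℕ) < q} = p := by
    rw [Fintype.card_subtype_compl, h1, Fintype.card_fin]; omega
  have h3 : (∏ i : Bool, (Fintype.card {a : Fin n // decide ((a : ℕ) < q) = i}).factorial) =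
      p.factorial * q.factorial := by
    rw [Fintype.prod_bool, mul_comm]
    congr 2
    · exact (Fintype.card_congr (Equiv.subtypeEquivRight (by simp))).trans h2
    · exact (Fintype.card_congr (Equiv.subtypeEquivRight (by simp))).trans h1
  rw [h3] at e
  rw [← e, Fintype.card_subtype, blockPerms]
  congr 1
  ext ρ
  simp [funext_iff]

theorem eq_of_unshuffles {q n : ℕ} {u v β : Perm (Fin n)} (hu : u ∈ unshuffles q n)
    (hv : v ∈ unshuffles q n) (hβ : β ∈ blockPerms q n) (h : β * u = v) : β = 1 := by
  rw [mem_unshuffles] at hu hv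
  rw [mem_blockPerms] at hβ
  have e : ∀ i, u.symm i = v.symm (β i) := by
    intro i
    rw [← h]
    simp [Equiv.Perm.mul_def]
  have hm : StrictMono β := by
    intro i j hij
    have hij' : (i : ℕ) < j := hij
    by_cases hj : (j : ℕ) < q
    · have hi : (i : ℕ) < q := by omega
      have := hu.1 hi hj hij
      rw [e, e] at this
      exact (hv.1.lt_iff_lt ((hβ i).2 hi) ((hβ j).2 hj)).1 this
    · have hj' : ¬ (β j : ℕ) < q := fun h => hj ((hβ j).1 h)
      by_cases hi : (i : ℕ) < q
      · have := (hβ i).2 hi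
        exact Fin.lt_def.2 (by omega)
      · have hi' : ¬ (β i : ℕ) < q := fun h => hi ((hβ i).1 h)
        have := hu.2 (not_lt.1 hi) (not_lt.1 hj) hij
        rw [e, e] at this
        exact (hv.2.lt_iff_lt (not_lt.1 hi') (not_lt.1 hj')).1 this
  have := (StrictMono.range_inj hm strictMono_id).1 (by simp [β.surjective.range_eq])
  ext i
  simp [this]

theorem exists_unshuffle {p q n : ℕ} (h : p + q = n) (σ : Perm (Fin n)) :
    ∃ ρ ∈ blockPerms q n, ∃ u ∈ unshuffles q n, ρ * u = σ := by
  obtain rfl : n = q + p := by omega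
  let s : Finset (Fin (q + p)) := Finset.univ.filter fun i => (σ i : ℕ) < q
  have hs : s.card = q := by
    have e : s.map σ.toEmbedding = Finset.univ.filter fun i : Fin (q + p) => (i : ℕ) < q := by
      ext i
      simp only [s, Finset.mem_map, Finset.mem_filter, Finset.mem_univ, true_and]
      exact ⟨by rintro ⟨j, hj, rfl⟩; exact hj, fun hi => ⟨σ.symm i, by simpa using hi, by simp⟩⟩
    rw [← Finset.card_map σ.toEmbedding, e]
    have := Fin.card_filter_val_lt (n := q + p) (m := q)
    omega
  have hs' : sᶜ.card = p := by rw [Finset.card_compl, hs, Fintype.card_fin]; omega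
  let u : Perm (Fin (q + p)) := (finSumFinEquiv.symm.trans (finSumEquivOfFinset hs hs')).symm
  have ul : ∀ j : Fin q, u.symm (Fin.castAdd p j) = s.orderEmbOfFin hs j := by
    intro j; simp [u]
  have ur : ∀ j : Fin p, u.symm (Fin.natAdd q j) = sᶜ.orderEmbOfFin hs' j := by
    intro j; simp [u]
  refine ⟨σ * u⁻¹, mem_blockPerms.2 fun i => ?_, u, mem_unshuffles.2 ⟨?_, ?_⟩, by simp⟩
  · change (σ (u.symm i) : ℕ) < q ↔ _
    refine Fin.addCases (fun j => ?_) (fun j => ?_) i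
    · have := s.orderEmbOfFin_mem hs j
      rw [ul]
      have := (Finset.mem_filter.1 this).2
      simpa using this
    · have := sᶜ.orderEmbOfFin_mem hs' j
      rw [ur]
      have : ¬ (σ _ : ℕ) < q := fun h =>
        Finset.mem_compl.1 this (Finset.mem_filter.2 ⟨Finset.mem_univ _, h⟩)
      simpa using this
  · intro i hi j hj hij
    have hi' : i = Fin.castAdd p ⟨i, hi⟩ := rfl
    have hj' : j = Fin.castAdd p ⟨j, hj⟩ := rfl
    rw [hi', hj', ul, ul]
    exact (s.orderEmbOfFin hs).strictMono hij
  · intro i hi j hj hij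
    simp only [Set.mem_ofPred_eq] at hi hj
    have hi' : i = Fin.natAdd q ⟨i - q, by omega⟩ := by ext; simp; omega
    have hj' : j = Fin.natAdd q ⟨j - q, by omega⟩ := by ext; simp; omega
    rw [hi', hj', ur, ur]
    refine (sᶜ.orderEmbOfFin hs').strictMono ?_
    have : (i : ℕ) < j := hij
    rw [Fin.lt_def]
    simp only
    omega

theorem sum_unshuffles {M : Type*} [AddCommMonoid M] {p q n : ℕ} (h : p + q = n)
    (f : Perm (Fin n) → M) (hf : ∀ ρ ∈ blockPerms q n, ∀ σ, f (ρ * σ) = f σ) :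
    ∑ σ, f σ = (p.factorial * q.factorial) • ∑ σ ∈ unshuffles q n, f σ := by
  rw [← card_blockPerms h, ← Finset.sum_const, ← Finset.sum_product']
  symm
  refine Finset.sum_nbij (fun x => x.1 * x.2) (by simp) ?_ ?_ ?_
  · rintro ⟨ρ, u⟩ hx ⟨ρ', u'⟩ hx' e
    simp only [Finset.coe_product, Set.mem_prod, Finset.mem_coe] at hx hx'
    simp only at e
    have hb : ρ'⁻¹ * ρ ∈ blockPerms q n := by
      have h1 := mem_blockPerms.1 hx.1
      have h2 := mem_blockPerms.1 hx'.1
      refine mem_blockPerms.2 fun i => ?_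
      rw [← h2]
      simp [h1]
    have h1 : ρ'⁻¹ * ρ = 1 := eq_of_unshuffles hx.2 hx'.2 hb (by rw [mul_assoc, e]; simp)
    have h2 : ρ = ρ' := by rw [inv_mul_eq_one] at h1; exact h1.symm
    subst h2
    simpa using e
  · intro σ _
    obtain ⟨ρ, hρ, u, hu, e⟩ := exists_unshuffle h σ
    exact ⟨(ρ, u), by simp [hρ, hu], e⟩
  · rintro ⟨ρ, u⟩ hx
    simp only [Finset.mem_product] at hx
    exact (hf ρ hx.1 u).symm

end Unshuffles

section Symmetrization

variable {K : Type u} [Field K] (P : GradedOperad K)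

theorem glue_inl_congr {m n r : ℕ} (h : m + n = r + 1) {i j : Fin m} (e : i = j) (x : Fin m)
    (hi : x ≠ i) (hj : x ≠ j) : glue h i (.inl ⟨x, hi⟩) = glue h j (.inl ⟨x, hj⟩) := by
  subst e; rfl

theorem blockPerm_inl {m n r : ℕ} (h : m + n = r + 1) (i : Fin m) (σ : Perm (Fin m))
    (τ : Perm (Fin n)) (x : Fin m) (hx : x ≠ i) : blockPerm h i σ τ (glue h i (.inl ⟨x, hx⟩)) =
      glue h (σ i) (.inl ⟨σ x, by simpa using hx⟩) := by
  simp [blockPerm]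

theorem blockPerm_inr {m n r : ℕ} (h : m + n = r + 1) (i : Fin m) (σ : Perm (Fin m))
    (τ : Perm (Fin n)) (j : Fin n) : blockPerm h i σ τ (glue h i (.inr j)) =
      glue h (σ i) (.inr (τ j)) := by
  simp [blockPerm]

theorem exists_blockPerm {p q n : ℕ} (h : p + 1 + q = n + 1) {ρ : Perm (Fin n)}
    (hρ : ρ ∈ blockPerms q n) : ∃ (σ : Perm (Fin (p + 1))) (τ : Perm (Fin q)),
      σ 0 = 0 ∧ blockPerm h 0 σ τ = ρ := by
  have gl : ∀ x, q ≤ (glue h 0 (.inl x) : ℕ) := by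
    rintro ⟨x, hx⟩
    have : (x : ℕ) ≠ 0 := fun e => hx (Fin.ext e)
    simp [glue]
    omega
  have gr : ∀ j, (glue h 0 (.inr j) : ℕ) < q := by intro j; simp [glue]
  rw [mem_blockPerms] at hρ
  obtain ⟨⟨s, τ⟩, e⟩ := MonoidHom.mem_range.1
    (Equiv.Perm.mem_sumCongrHom_range_of_perm_mapsTo_inl
      (σ := ((glue h 0).trans ρ).trans (glue h 0).symm) (by
      rintro _ ⟨x, rfl⟩
      rcases hy : (((glue h 0).trans ρ).trans (glue h 0).symm) (.inl x) with y | y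
      · exact ⟨y, rfl⟩
      · exfalso
        simp only [Equiv.trans_apply, Equiv.symm_apply_eq] at hy
        have h1 := gr y
        rw [← hy, hρ] at h1
        have h2 := gl x
        omega))
  have e' : ∀ z, glue h 0 (Equiv.Perm.sumCongr s τ z) = ρ (glue h 0 z) := by
    intro z
    have := congrArg (fun f => glue h 0 (f z)) e
    simpa using this
  have h0 : Equiv.Perm.ofSubtype s 0 = 0 := Equiv.Perm.ofSubtype_apply_of_not_mem _ (by simp)
  refine ⟨Equiv.Perm.ofSubtype s, τ, h0, ?_⟩
  ext y
  obtain ⟨z, rfl⟩ := (glue h 0).surjective y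
  rw [← e']
  congr 1
  rcases z with ⟨x, hx⟩ | j
  · rw [blockPerm_inl]
    have hs : Equiv.Perm.ofSubtype s x = s ⟨x, hx⟩ := Equiv.Perm.ofSubtype_apply_of_mem s hx
    refine (glue_inl_congr h h0 _ _ (by rw [hs]; exact (s ⟨x, hx⟩).2)).trans ?_
    simp [hs]
  · rw [blockPerm_inr, h0]
    simp

/-- The sum of all `x^σ`. -/
def GradedOperad.sym {n : ℕ} {a : ℤ} : P.obj n a →ₗ[K] P.obj n a := ∑ σ, P.act σ

theorem GradedOperad.sym_apply {n : ℕ} {a : ℤ} (x : P.obj n a) : P.sym x = ∑ σ, P.act σ x := by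
  simp [sym]

theorem GradedOperad.sym_act {n : ℕ} {a : ℤ} (τ : Perm (Fin n)) (x : P.obj n a) :
    P.sym (P.act τ x) = P.sym x := by
  simp only [sym_apply, ← P.act_mul]
  exact Fintype.sum_equiv (Equiv.mulLeft τ) _ _ fun _ => rfl

theorem GradedOperad.act_sym {n : ℕ} {a : ℤ} (τ : Perm (Fin n)) (x : P.obj n a) :
    P.act τ (P.sym x) = P.sym x := by
  simp only [sym_apply, map_sum, ← P.act_mul]
  exact Fintype.sum_equiv (Equiv.mulRight τ) _ _ fun _ => rfl

/-- An operation that is invariant under all permutations of its inputs. -/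
def GradedOperad.IsSym {n : ℕ} {a : ℤ} (x : P.obj n a) : Prop := ∀ σ, P.act σ x = x

variable {P}

theorem GradedOperad.sym_comp_act {m n r : ℕ} {a b c : ℤ} (h : m + n = r + 1) (h' : a + b = c)
    (i : Fin m) (σ : Perm (Fin m)) (τ : Perm (Fin n)) (x : P.obj m a) (y : P.obj n b) :
    P.sym (P.comp h h' i (P.act σ x) (P.act τ y)) = P.sym (P.comp h h' (σ i) x y) := by
  rw [P.comp_act, P.sym_act]

theorem GradedOperad.sym_comp_act_right {m n r : ℕ} {a b c : ℤ} (h : m + n = r + 1)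
    (h' : a + b = c) (i : Fin m) (τ : Perm (Fin n)) (x : P.obj m a) (y : P.obj n b) :
    P.sym (P.comp h h' i x (P.act τ y)) = P.sym (P.comp h h' i x y) := by
  have := GradedOperad.sym_comp_act h h' i 1 τ x y
  rwa [P.act_one] at this

theorem GradedOperad.sym_comp_sym_right {m n r : ℕ} {a b c : ℤ} (h : m + n = r + 1)
    (h' : a + b = c) (i : Fin m) (x : P.obj m a) (y : P.obj n b) :
    P.sym (P.comp h h' i x (P.sym y)) = (n.factorial : K) • P.sym (P.comp h h' i x y) := by
  rw [P.sym_apply y, map_sum, map_sum,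
    Finset.sum_congr rfl fun τ _ => GradedOperad.sym_comp_act_right h h' i τ x y]
  simp [Fintype.card_perm, Nat.cast_smul_eq_nsmul]

theorem GradedOperad.sym_comp_sym_left {p n r : ℕ} {a b c : ℤ} (h : p + 1 + n = r + 1)
    (h' : a + b = c) (x : P.obj (p + 1) a) (y : P.obj n b) :
    P.sym (P.comp h h' 0 (P.sym x) y) =
      (p.factorial : K) • ∑ i, P.sym (P.comp h h' i x y) := by
  have e : ∀ σ, P.sym (P.comp h h' 0 (P.act σ x) y) = P.sym (P.comp h h' (σ 0) x y) := by
    intro σ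
    have := GradedOperad.sym_comp_act h h' 0 σ 1 x y
    rwa [P.act_one] at this
  rw [P.sym_apply x, map_sum, LinearMap.sum_apply, map_sum, Finset.sum_congr rfl fun σ _ => e σ,
    ← Equiv.sum_comp Equiv.Perm.decomposeFin.symm, Fintype.sum_prod_type]
  simp [Fintype.card_perm, Nat.cast_smul_eq_nsmul, Finset.smul_sum]

/-- A composite of two symmetric operations is invariant under the permutations that preserve the
block of the inputs of the second one. -/
theorem GradedOperad.IsSym.act_comp {p q n : ℕ} {a b c : ℤ} (h : p + 1 + q = n + 1)
    (h' : a + b = c) {x : P.obj (p + 1) a} {y : P.obj q b} (hx : P.IsSym x) (hy : P.IsSym y)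
    {ρ : Perm (Fin n)} (hρ : ρ ∈ blockPerms q n) :
    P.act ρ (P.comp h h' 0 x y) = P.comp h h' 0 x y := by
  obtain ⟨σ, τ, h0, rfl⟩ := exists_blockPerm h hρ
  have := P.comp_act h h' 0 σ τ x y
  rw [hx, hy, h0] at this
  exact this.symm

theorem GradedOperad.IsSym.sum_unshuffles {p q n : ℕ} {a b c : ℤ} (h : p + 1 + q = n + 1)
    (h' : a + b = c) {x : P.obj (p + 1) a} {y : P.obj q b} (hx : P.IsSym x) (hy : P.IsSym y) :
    P.sym (P.comp h h' 0 x y) = (p.factorial * q.factorial : K) •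
      ∑ σ ∈ unshuffles q n, P.act σ (P.comp h h' 0 x y) := by
  rw [P.sym_apply, SymOp.sum_unshuffles (show p + q = n by omega)
    (fun σ => P.act σ (P.comp h h' 0 x y)), ← Nat.cast_mul, Nat.cast_smul_eq_nsmul]
  intro ρ hρ σ
  rw [P.act_mul, hx.act_comp h h' hy hρ]

theorem GradedOperad.IsSym.exists_comp {m n r : ℕ} {a b c : ℤ} (h : m + n = r + 1) (h' : a + b = c)
    {x : P.obj m a} (hx : P.IsSym x) (i j : Fin m) (y : P.obj n b) :
    ∃ ρ, P.comp h h' i x y = P.act ρ (P.comp h h' j x y) := by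
  have := P.comp_act h h' i (Equiv.swap i j) 1 x y
  rw [hx, P.act_one, Equiv.swap_apply_left] at this
  exact ⟨_, this⟩

end Symmetrization

section CurvedLInfinity

variable {K : Type u} [Field K]

/-- The formula for the differential of the curved L-infinity operad: for operations `ℓ_n` of arity
`n` and degree `-1`,
`- ∑_{p + q = n} ∑_σ (ℓ_{p+1} ∘_0 ℓ_q)^σ`, with `σ` running over the unshuffles. -/
def linfD (P : GradedOperad K) (l : ∀ n, P.obj n (-1)) (n : ℕ) : P.obj n (-1 - 1) :=
  - ∑ pq : Finset.HasAntidiagonal.antidiagonal n, ∑ σ ∈ unshuffles pq.1.2 n,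
      P.act σ (P.comp (r := n)
        (show pq.1.1 + 1 + pq.1.2 = n + 1 by have := Finset.HasAntidiagonal.mem_antidiagonal.1 pq.2; omega)
        (show (-1 : ℤ) + -1 = -1 - 1 by norm_num) 0 (l (pq.1.1 + 1)) (l pq.1.2))

variable {P : GradedOperad K} (l : ∀ n, P.obj n (-1))

/-- The symmetrization of `ℓ_{p+1} ∘ ℓ_q` for `p + q = n`. -/
def linfBin (n p q : ℕ) : P.obj n (-1 - 1) :=
  if h : p + q = n then
    P.sym (P.comp (r := n) (show p + 1 + q = n + 1 by omega)
      (show (-1 : ℤ) + -1 = -1 - 1 by norm_num) 0 (l (p + 1)) (l q))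
  else 0

/-- The symmetrization of `ℓ_{a+1} ∘ (ℓ_{b+1} ∘ ℓ_q)` for `a + b + q = n`. -/
def linfNest (n a b q : ℕ) : P.obj n (-1 - 1 - 1) :=
  if h : a + b + q = n then
    P.sym (P.comp (r := n) (show a + 1 + (b + q) = n + 1 by omega)
      (show (-1 : ℤ) + (-1 - 1) = -1 - 1 - 1 by norm_num) 0 (l (a + 1))
      (P.comp (r := b + q) (show b + 1 + q = b + q + 1 by omega)
        (show (-1 : ℤ) + -1 = -1 - 1 by norm_num) 0 (l (b + 1)) (l q)))
  else 0

/-- The symmetrization of `(ℓ_{a+2} ∘ ℓ_b) ∘ ℓ_q` for `a + b + q = n`, with `ℓ_b` and `ℓ_q` in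
different inputs. -/
def linfPar (n a b q : ℕ) : P.obj n (-1 - 1 - 1) :=
  if h : a + b + q = n then
    P.sym (P.comp (r := n) (show a + 1 + b + q = n + 1 by omega)
      (show (-1 - 1 : ℤ) + -1 = -1 - 1 - 1 by norm_num) ⟨b, by omega⟩
      (P.comp (r := a + 1 + b) (show a + 1 + 1 + b = a + 1 + b + 1 by omega)
        (show (-1 : ℤ) + -1 = -1 - 1 by norm_num) 0 (l (a + 1 + 1)) (l b)) (l q))
  else 0

variable {l}

theorem linfD_eq [CharZero K] (hl : ∀ n, P.IsSym (l n)) (n : ℕ) : linfD P l n =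
    - ∑ pq ∈ Finset.HasAntidiagonal.antidiagonal n,
      (pq.1.factorial * pq.2.factorial : K)⁻¹ • linfBin l n pq.1 pq.2 := by
  rw [linfD, ← Finset.sum_coe_sort (Finset.HasAntidiagonal.antidiagonal n)]
  congr 1
  refine Finset.sum_congr rfl fun pq _ => ?_
  have h := Finset.HasAntidiagonal.mem_antidiagonal.1 pq.2
  rw [linfBin, dif_pos h, (hl _).sum_unshuffles _ _ (hl _), smul_smul, inv_mul_cancel₀, one_smul]
  simp [Nat.factorial_ne_zero]

theorem act_linfD [CharZero K] (hl : ∀ n, P.IsSym (l n)) (n : ℕ) (τ : Perm (Fin n)) :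
    P.act τ (linfD P l n) = linfD P l n := by
  rw [linfD_eq hl, map_neg, map_sum]
  congr 1
  refine Finset.sum_congr rfl fun pq _ => ?_
  rw [map_smul, linfBin]
  split_ifs
  · rw [P.act_sym]
  · rw [map_zero]

theorem linfPar_comm (hl : ∀ n, P.IsSym (l n)) (n a b q : ℕ) : linfPar l n a b q = - linfPar l n a q b := by
  by_cases h : a + b + q = n
  · have h' : a + q + b = n := by omega
    rw [linfPar, linfPar, dif_pos h, dif_pos h']
    have e := P.comp_comm (show a + 1 + 1 + b = a + 1 + b + 1 by omega)
      (show a + 1 + b + q = n + 1 by omega) (show a + 1 + 1 + q = a + 1 + q + 1 by omega)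
      (show a + 1 + q + b = n + 1 by omega) (show (-1 : ℤ) + -1 = -1 - 1 by norm_num)
      (show (-1 - 1 : ℤ) + -1 = -1 - 1 - 1 by norm_num) (show (-1 : ℤ) + -1 = -1 - 1 by norm_num)
      (show (-1 - 1 : ℤ) + -1 = -1 - 1 - 1 by norm_num) 0 1 ⟨0, by omega⟩ ⟨b, by omega⟩
      (by simp) rfl (by simp; omega) (l (a + 1 + 1)) (l b) (l q)
    rw [e]
    have hs : ksign K (-1 * -1) = -1 := by simp [ksign]
    rw [hs, neg_smul, one_smul, map_neg, neg_inj]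
    have e1 := P.comp_act (show a + 1 + 1 + q = a + 1 + q + 1 by omega)
      (show (-1 : ℤ) + -1 = -1 - 1 by norm_num) 1 (Equiv.swap 0 1) 1 (l (a + 1 + 1)) (l q)
    rw [hl, P.act_one, Equiv.swap_apply_right] at e1
    have e2 := GradedOperad.sym_comp_act (show a + 1 + q + b = n + 1 by omega)
      (show (-1 - 1 : ℤ) + -1 = -1 - 1 - 1 by norm_num) ⟨0, by omega⟩
      (blockPerm (show a + 1 + 1 + q = a + 1 + q + 1 by omega) 1 (Equiv.swap 0 1) 1) 1
      (P.comp (show a + 1 + 1 + q = a + 1 + q + 1 by omega)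
        (show (-1 : ℤ) + -1 = -1 - 1 by norm_num) 0 (l (a + 1 + 1)) (l q)) (l b)
    have e3 : blockPerm (show a + 1 + 1 + q = a + 1 + q + 1 by omega) 1 (Equiv.swap 0 1) 1
        ⟨0, by omega⟩ = ⟨q, by omega⟩ := by
      have e4 := blockPerm_inl (show a + 1 + 1 + q = a + 1 + q + 1 by omega) 1 (Equiv.swap 0 1) 1
        0 (by simp)
      have e5 : glue (show a + 1 + 1 + q = a + 1 + q + 1 by omega) 1 (.inl ⟨0, by simp⟩) =
          ⟨0, by omega⟩ := by simp [glue]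
      rw [e5] at e4
      rw [e4]
      ext
      simp [glue]
    rw [P.act_one, e3, ← e1] at e2
    exact e2
  · rw [linfPar, linfPar, dif_neg h, dif_neg (by omega), neg_zero]

theorem sym_comp_linfD [CharZero K] (hl : ∀ n, P.IsSym (l n)) {n p q : ℕ} (h : p + q = n) :
    P.sym (P.comp (r := n) (show p + 1 + q = n + 1 by omega)
      (show (-1 : ℤ) + (-1 - 1) = -1 - 1 - 1 by norm_num) 0 (l (p + 1)) (linfD P l q)) =
    - ∑ ab ∈ Finset.HasAntidiagonal.antidiagonal q,
      (q.factorial : K) • (ab.1.factorial * ab.2.factorial : K)⁻¹ • linfNest l n p ab.1 ab.2 := by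
  rw [linfD_eq hl, map_neg, map_neg, map_sum, map_sum]
  congr 1
  refine Finset.sum_congr rfl fun ab hab => ?_
  rw [Finset.HasAntidiagonal.mem_antidiagonal] at hab
  subst hab
  rw [map_smul, map_smul, linfBin, dif_pos rfl, GradedOperad.sym_comp_sym_right, linfNest,
    dif_pos (by omega), smul_comm]

theorem sum_sym_comp_comp (hl : ∀ n, P.IsSym (l n)) {n p q a b : ℕ} (h : p + q = n)
    (h' : a + b = p + 1) :
    ∑ i, P.sym (P.comp (r := n) (show p + 1 + q = n + 1 by omega)
      (show (-1 - 1 : ℤ) + -1 = -1 - 1 - 1 by norm_num) i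
      (P.comp (r := p + 1) (show a + 1 + b = p + 1 + 1 by omega)
        (show (-1 : ℤ) + -1 = -1 - 1 by norm_num) 0 (l (a + 1)) (l b)) (l q)) =
    (b : K) • linfNest l n a (b - 1) q + (a : K) • linfPar l n (a - 1) b q := by
  have key : ∀ i : Fin (p + 1), P.sym (P.comp (r := n) (show p + 1 + q = n + 1 by omega)
      (show (-1 - 1 : ℤ) + -1 = -1 - 1 - 1 by norm_num) i
      (P.comp (r := p + 1) (show a + 1 + b = p + 1 + 1 by omega)
        (show (-1 : ℤ) + -1 = -1 - 1 by norm_num) 0 (l (a + 1)) (l b)) (l q)) =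
      if (i : ℕ) < b then linfNest l n a (b - 1) q else linfPar l n (a - 1) b q := by
    intro i
    split_ifs with hi
    · obtain ⟨b, rfl⟩ : ∃ b', b = b' + 1 := ⟨b - 1, by omega⟩
      rw [P.comp_assoc _ _ (show b + 1 + q = b + q + 1 by omega) (by omega) _ _
        (show (-1 : ℤ) + -1 = -1 - 1 by norm_num) (by norm_num) 0 ⟨i, hi⟩ i (by simp)]
      obtain ⟨ρ, hρ⟩ := (hl (b + 1)).exists_comp (show b + 1 + q = b + q + 1 by omega)
        (show (-1 : ℤ) + -1 = -1 - 1 by norm_num) ⟨i, hi⟩ 0 (l q)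
      rw [hρ, GradedOperad.sym_comp_act_right, linfNest, dif_pos (by omega)]
      rfl
    · obtain ⟨a, rfl⟩ : ∃ a', a = a' + 1 := ⟨a - 1, by omega⟩
      obtain rfl : p = a + b := by omega
      have hb : b < a + b + 1 := by omega
      have e := (hl (a + 1 + 1)).act_comp (show a + 1 + 1 + b = a + b + 1 + 1 by omega)
        (show (-1 : ℤ) + -1 = -1 - 1 by norm_num) (hl b) (ρ := Equiv.swap i ⟨b, hb⟩) (by
          refine mem_blockPerms.2 fun j => ?_
          rw [Equiv.swap_apply_def]
          split_ifs with h1 h2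
          · subst h1; simp; omega
          · subst h2; simp; omega
          · rfl)
      have e2 := GradedOperad.sym_comp_act (show a + b + 1 + q = n + 1 by omega)
        (show (-1 - 1 : ℤ) + -1 = -1 - 1 - 1 by norm_num) i (Equiv.swap i ⟨b, hb⟩) 1
        (P.comp (r := a + b + 1) (show a + 1 + 1 + b = a + b + 1 + 1 by omega)
          (show (-1 : ℤ) + -1 = -1 - 1 by norm_num) 0 (l (a + 1 + 1)) (l b)) (l q)
      rw [e, P.act_one, Equiv.swap_apply_left] at e2
      rw [e2, linfPar, dif_pos (by omega)]
      have e3 : ∀ (s : ℕ) (hs : s = a + b + 1) (h1 : a + 1 + 1 + b = s + 1) (h2 : s + q = n + 1)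
          (h3 : b < s), P.sym (P.comp (r := n) (show a + b + 1 + q = n + 1 by omega)
            (show (-1 - 1 : ℤ) + -1 = -1 - 1 - 1 by norm_num) ⟨b, hb⟩
            (P.comp (r := a + b + 1) (show a + 1 + 1 + b = a + b + 1 + 1 by omega)
              (show (-1 : ℤ) + -1 = -1 - 1 by norm_num) 0 (l (a + 1 + 1)) (l b)) (l q)) =
          P.sym (P.comp (r := n) h2 (show (-1 - 1 : ℤ) + -1 = -1 - 1 - 1 by norm_num) ⟨b, h3⟩
            (P.comp (r := s) h1
              (show (-1 : ℤ) + -1 = -1 - 1 by norm_num) 0 (l (a + 1 + 1)) (l b)) (l q)) := by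
        rintro s rfl h1 h2 h3
        rfl
      exact e3 _ (by omega) _ _ _
  rw [Finset.sum_congr rfl fun i _ => key i, Finset.sum_ite, Finset.sum_const, Finset.sum_const,
    ← Nat.cast_smul_eq_nsmul K, ← Nat.cast_smul_eq_nsmul K]
  have c1 : (Finset.univ.filter fun i : Fin (p + 1) => (i : ℕ) < b).card = b := by
    have := Fin.card_filter_val_lt (n := p + 1) (m := b)
    omega
  have c2 : (Finset.univ.filter fun i : Fin (p + 1) => ¬ (i : ℕ) < b).card = a := by
    have := Finset.card_filter_add_card_filter_not (s := Finset.univ)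
      (fun i : Fin (p + 1) => (i : ℕ) < b)
    rw [c1, Finset.card_univ, Fintype.card_fin] at this
    omega
  rw [c1, c2]

theorem sym_linfD_comp [CharZero K] (hl : ∀ n, P.IsSym (l n)) {n p q : ℕ} (h : p + q = n) :
    P.sym (P.comp (r := n) (show p + 1 + q = n + 1 by omega)
      (show (-1 - 1 : ℤ) + -1 = -1 - 1 - 1 by norm_num) 0 (linfD P l (p + 1)) (l q)) =
    - ((p.factorial : K) • (∑ ab ∈ Finset.HasAntidiagonal.antidiagonal p,
        (ab.1.factorial * ab.2.factorial : K)⁻¹ • linfNest l n ab.1 ab.2 q +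
      ∑ ab ∈ Finset.HasAntidiagonal.antidiagonal p,
        (ab.1.factorial * ab.2.factorial : K)⁻¹ • linfPar l n ab.1 ab.2 q)) := by
  have e : ∀ ab ∈ Finset.HasAntidiagonal.antidiagonal (p + 1),
      P.sym (P.comp (r := n) (show p + 1 + q = n + 1 by omega)
        (show (-1 - 1 : ℤ) + -1 = -1 - 1 - 1 by norm_num) 0 ((ab.1.factorial * ab.2.factorial : K)⁻¹ •
          linfBin l (p + 1) ab.1 ab.2) (l q)) =
      (p.factorial : K) • ((ab.1.factorial * ab.2.factorial : K)⁻¹ •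
          (ab.2 : K) • linfNest l n ab.1 (ab.2 - 1) q +
        (ab.1.factorial * ab.2.factorial : K)⁻¹ • (ab.1 : K) • linfPar l n (ab.1 - 1) ab.2 q) := by
    intro ab hab
    rw [Finset.HasAntidiagonal.mem_antidiagonal] at hab
    rw [map_smul, LinearMap.smul_apply, map_smul, linfBin, dif_pos hab,
      GradedOperad.sym_comp_sym_left, sum_sym_comp_comp hl h hab, smul_comm, smul_add]
  have f1 : ∀ (k : ℕ), ((k + 1 : ℕ) : K) ≠ 0 := fun k => by exact_mod_cast Nat.succ_ne_zero k
  rw [linfD_eq hl, map_neg, map_sum, LinearMap.neg_apply, LinearMap.sum_apply, map_neg, map_sum,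
    Finset.sum_congr rfl e, ← Finset.smul_sum, Finset.sum_add_distrib,
    Finset.Nat.sum_antidiagonal_succ', Finset.Nat.sum_antidiagonal_succ (n := p) (f := fun ab =>
      (ab.1.factorial * ab.2.factorial : K)⁻¹ • (ab.1 : K) • linfPar l n (ab.1 - 1) ab.2 q)]
  simp only [Nat.cast_zero, zero_smul, smul_zero, zero_add, Nat.add_sub_cancel]
  congr 3
  · refine Finset.sum_congr rfl fun ab _ => ?_
    rw [smul_smul]
    congr 1
    have := f1 ab.2
    have h2 : (ab.2.factorial : K) ≠ 0 := by exact_mod_cast ab.2.factorial_ne_zero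
    have h3 : (ab.1.factorial : K) ≠ 0 := by exact_mod_cast ab.1.factorial_ne_zero
    rw [Nat.factorial_succ, Nat.cast_mul]
    field_simp
  · refine Finset.sum_congr rfl fun ab _ => ?_
    rw [smul_smul]
    congr 1
    have := f1 ab.1
    have h2 : (ab.2.factorial : K) ≠ 0 := by exact_mod_cast ab.2.factorial_ne_zero
    have h3 : (ab.1.factorial : K) ≠ 0 := by exact_mod_cast ab.1.factorial_ne_zero
    rw [Nat.factorial_succ, Nat.cast_mul]
    field_simp

theorem sum_antidiagonal_assoc {M : Type*} [AddCommMonoid M] (n : ℕ) (f : ℕ → ℕ → ℕ → M) :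
    ∑ x ∈ Finset.HasAntidiagonal.antidiagonal n,
      ∑ y ∈ Finset.HasAntidiagonal.antidiagonal x.1, f y.1 y.2 x.2 =
    ∑ x ∈ Finset.HasAntidiagonal.antidiagonal n,
      ∑ y ∈ Finset.HasAntidiagonal.antidiagonal x.2, f x.1 y.1 y.2 := by
  rw [Finset.sum_sigma', Finset.sum_sigma']
  refine Finset.sum_nbij' (fun z => ⟨(z.2.1, z.2.2 + z.1.2), (z.2.2, z.1.2)⟩)
    (fun z => ⟨(z.1.1 + z.2.1, z.2.2), (z.1.1, z.2.1)⟩) ?_ ?_ ?_ ?_ ?_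
  all_goals
    rintro ⟨⟨a, b⟩, c, d⟩ h
    simp only [Finset.mem_sigma, Finset.HasAntidiagonal.mem_antidiagonal] at h
    obtain ⟨h1, h2⟩ := h
    subst h2
    simp only [Finset.mem_sigma, Finset.HasAntidiagonal.mem_antidiagonal]
  · exact ⟨by omega, trivial⟩
  · exact ⟨by omega, trivial⟩

theorem Derivation.d_linfD [CharZero K] (d : Derivation P) (hl : ∀ n, P.IsSym (l n))
    (hd : ∀ n, d.toFun (l n) = linfD P l n) (n : ℕ) : d.toFun (linfD P l n) = 0 := by
  have hs : ∀ x : P.obj n (-1 - 1), d.toFun (P.sym x) = P.sym (d.toFun x) := by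
    intro x
    simp only [P.sym_apply, map_sum, d.map_act]
  have f : ∀ k : ℕ, (k.factorial : K) ≠ 0 := fun k => by exact_mod_cast Nat.factorial_ne_zero k
  have e : ∀ pq ∈ Finset.HasAntidiagonal.antidiagonal n,
      (pq.1.factorial * pq.2.factorial : K)⁻¹ • d.toFun (linfBin l n pq.1 pq.2) =
      ∑ ab ∈ Finset.HasAntidiagonal.antidiagonal pq.2,
        (pq.1.factorial * ab.1.factorial * ab.2.factorial : K)⁻¹ • linfNest l n pq.1 ab.1 ab.2 -
      ∑ ab ∈ Finset.HasAntidiagonal.antidiagonal pq.1,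
        (ab.1.factorial * ab.2.factorial * pq.2.factorial : K)⁻¹ • linfNest l n ab.1 ab.2 pq.2 -
      ∑ ab ∈ Finset.HasAntidiagonal.antidiagonal pq.1,
        (ab.1.factorial * ab.2.factorial * pq.2.factorial : K)⁻¹ •
          linfPar l n ab.1 ab.2 pq.2 := by
    intro pq hpq
    rw [Finset.HasAntidiagonal.mem_antidiagonal] at hpq
    have k1 : ksign K (-1) = -1 := by simp [ksign]
    rw [linfBin, dif_pos hpq, hs, d.map_comp, hd, hd, k1, map_add, map_smul, sym_linfD_comp hl hpq,
      sym_comp_linfD hl hpq, smul_add, smul_neg, smul_smul, smul_add, neg_smul, one_smul, neg_neg,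
      Finset.smul_sum, Finset.smul_sum, Finset.smul_sum]
    have c1 : ∀ x y : K, (pq.1.factorial * pq.2.factorial : K)⁻¹ * pq.1.factorial * (x * y)⁻¹ =
        (x * y * pq.2.factorial)⁻¹ := by
      intro x y
      rw [mul_inv, mul_inv _ (pq.2.factorial : K), mul_comm _⁻¹ _⁻¹, mul_assoc _⁻¹ _⁻¹,
        inv_mul_cancel₀ (f _), mul_one, mul_comm]
    have c2 : ∀ x y : K, (pq.1.factorial * pq.2.factorial : K)⁻¹ * (pq.2.factorial * (x * y)⁻¹) =
        (pq.1.factorial * x * y)⁻¹ := by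
      intro x y
      rw [mul_inv, mul_assoc, ← mul_assoc _⁻¹ _ (x * y)⁻¹, inv_mul_cancel₀ (f _), one_mul,
        ← mul_inv, mul_assoc]
    simp only [smul_smul, c1, c2]
    abel
  rw [linfD_eq hl, map_neg, map_sum, neg_eq_zero]
  simp only [map_smul]
  rw [Finset.sum_congr rfl e, Finset.sum_sub_distrib, Finset.sum_sub_distrib,
    sum_antidiagonal_assoc n (fun a b q =>
      (a.factorial * b.factorial * q.factorial : K)⁻¹ • linfNest l n a b q), sub_self, zero_sub,
    neg_eq_zero]
  set S := ∑ x ∈ Finset.HasAntidiagonal.antidiagonal n,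
    ∑ y ∈ Finset.HasAntidiagonal.antidiagonal x.1,
      (y.1.factorial * y.2.factorial * x.2.factorial : K)⁻¹ • linfPar l n y.1 y.2 x.2 with hS
  have hneg : S = - S := by
    conv_lhs => rw [hS, sum_antidiagonal_assoc n (fun a b q =>
      (a.factorial * b.factorial * q.factorial : K)⁻¹ • linfPar l n a b q)]
    rw [hS, sum_antidiagonal_assoc n (fun a b q =>
      (a.factorial * b.factorial * q.factorial : K)⁻¹ • linfPar l n a b q),
      ← Finset.sum_neg_distrib]
    refine Finset.sum_congr rfl fun x _ => ?_
    refine Finset.Nat.sum_antidiagonal_swap.symm.trans ?_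
    rw [← Finset.sum_neg_distrib]
    refine Finset.sum_congr rfl fun y _ => ?_
    simp only [Prod.fst_swap, Prod.snd_swap]
    rw [linfPar_comm hl, smul_neg, mul_right_comm]
  have h2 : (2 : K) • S = 0 := by rw [two_smul]; nth_rw 1 [hneg]; exact neg_add_cancel S
  exact (smul_eq_zero.1 h2).resolve_left two_ne_zero

variable (K)

/-- The generators of the curved L-infinity operad: `ℓ_n` of arity `n` and degree `-1`, for every
`n ≥ 0`. -/
inductive LGen : ℕ → ℤ → Type u
  | ell (n : ℕ) : LGen n (-1)

/-- The relations `ℓ_n^σ = ℓ_n`: the free operad on the symmetric sequence of the `ℓ_n`, with trivial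
actions of the symmetric groups, has no others. -/
inductive LRel : ∀ n a, Term K LGen.{u} n a → Term K LGen.{u} n a → Prop
  | sym (n : ℕ) (σ : Perm (Fin n)) : LRel n (-1) (.act σ (.gen (.ell n))) (.gen (.ell n))

/-- The generating operation `ℓ_n`. -/
def lgen (n : ℕ) : (presented (LRel K)).obj n (-1) := gen (LGen.ell n)

theorem isSym_lgen (n : ℕ) : (presented (LRel K)).IsSym (lgen K n) :=
  fun σ => cls_sound (.of (.sym n σ))

/-- The differential of the curved L-infinity operad on generators. -/
def dLGen : ∀ n a, LGen.{u} n a → (presented (LRel K)).obj n (a - 1)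
  | _, _, .ell n => linfD (presented (LRel K)) (lgen K) n

theorem dLGen_rel [CharZero K] (n : ℕ) (a : ℤ) (x y : Term K LGen.{u} n a) (h : LRel K n a x y) :
    x.der (dLGen K) = y.der (dLGen K) := by
  cases h with
  | sym σ => exact act_linfD (isSym_lgen K) _ σ

/-- The (shifted) curved L-infinity dg operad: the free symmetric operad on generators `ℓ_n`, `n ≥ 0`,
with `d ℓ_n = - ∑_{p + q = n} ∑_σ (ℓ_{p+1} ∘_0 ℓ_q)^σ`. -/
def cLinf [CharZero K] : DGOperad K :=
  presentedDG (LRel K) (dLGen K) (dLGen_rel K) (by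
    intro n a g
    cases g with
    | ell => exact (presentedDer (dLGen K) (dLGen_rel K)).d_linfD (isSym_lgen K) (fun _ => rfl) n)

/-- The operation `ℓ_n` of the curved L-infinity operad. -/
def ell [CharZero K] (n : ℕ) : (cLinf K).op.obj n (-1) := lgen K n

end CurvedLInfinity

section Twisting

variable (K : Type u) [Field K] [CharZero K]

/-- The element `α` of `cL_∞ ∨ T`. -/
def alpha : (coprod (cLinf K) (T K)).op.obj 0 0 := inr (gen (R := noRel K TGen) TGen.alpha)

/-- The element `κ` of `cL_∞ ∨ T`. -/
def kappa : (coprod (cLinf K) (T K)).op.obj 0 (-1) := inr (gen (R := noRel K TGen) TGen.kappa)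

/-- `x(α^k, -)`: the element `α` is inserted into the first `k` inputs of `x`. -/
def insertAlpha {n : ℕ} {a : ℤ} : ∀ k : ℕ, (coprod (cLinf K) (T K)).op.obj (n + k) a →
    (coprod (cLinf K) (T K)).op.obj n a
  | 0, x => x
  | k + 1, x => insertAlpha k ((coprod (cLinf K) (T K)).op.comp (m := n + k + 1) (n := 0)
      (r := n + k) rfl (add_zero a) 0 x (alpha K))

/-- The `k`-th term `(1 / k!) ℓ_{k+n}(α^k, -)` of the twisted operation. -/
def twistTerm (n k : ℕ) : (coprod (cLinf K) (T K)).op.obj n (-1) :=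
  (k.factorial : K)⁻¹ • insertAlpha K k (inl (ell K (n + k)))

theorem isAlphaPow_insertAlpha {n : ℕ} {a : ℤ} (k j : ℕ)
    (x : (coprod (cLinf K) (T K)).op.obj (n + k) a) (hx : IsAlphaPow (cLinf K) j x) :
    IsAlphaPow (cLinf K) (j + k) (insertAlpha K k x) := by
  induction k generalizing j with
  | zero => exact hx
  | succ k ih =>
      have := ih (j + 1) _ (IsAlphaPow.comp (m := n + k + 1) (r := n + k) rfl (add_zero a) 0 hx
        IsAlphaPow.alpha)
      rwa [show j + (k + 1) = j + 1 + k by omega]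

theorem twistTerm_mem (n k : ℕ) :
    twistTerm K n k ∈ (alphaFiltration (cLinf K)).F k n (-1) := by
  have := isAlphaPow_insertAlpha K k 0 (inl (ell K (n + k))) (.of_zero _)
  rw [zero_add] at this
  exact IsAlphaPow.smul _ this

/-- The twisted operation `∑_{k ≥ 0} (1 / k!) ℓ_{k+n}(α^k, -)` in the completed coproduct of `cL_∞`
and `T`. -/
def twistedEll (n : ℕ) : (completedCoprodT (cLinf K)).op.obj n (-1) :=
  (alphaFiltration (cLinf K)).series (twistTerm K n) (twistTerm_mem K n)

/-- The element `κ` of the completed coproduct of `cL_∞` and `T`. -/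
def kappaHat : (completedCoprodT (cLinf K)).op.obj 0 (-1) :=
  (alphaFiltration (cLinf K)).toCompleted (kappa K)

end Twisting

end SymOp

/-! Morphisms out of `cLinf K` are determined by their values on the generators ℓ_n, which gives
uniqueness. For existence, the proposed values L_n must be invariant under permutations and satisfy
the equation that d imposes on the ℓ_n. This equation becomes quadratic once it is written for whole
families X = (X_n). Put [X, Y]_n = ∑_{p+q=n} sym(X_{p+1} ∘ Y_q) / (p! q!). For symmetric families
the sum over unshuffles is exactly this normalized symmetrization, so the condition on L is dL =
-[L, L]. Let D be the operator on families that inserts α into one input (`feed`), and D_κ the same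
for κ. Three facts carry the proof. (1) D is a derivation of the bracket (`feed_bracket`), because α
has degree 0 and enters either the inner or the outer operation. Hence exp(D), whose components are
the families `twist`, is multiplicative: ∑_{i+j=k} [D^i X / i!, D^j X / j!] obeys the same recursion
as D^k [X, X] / k! (`feed_twistBracket`). (2) The differential commutes with D up to ±D_κ, since dα
= κ, and D commutes with D_κ. As ℓ has degree -1, this gives d exp(D)ℓ = -[exp(D)ℓ, exp(D)ℓ] - D_κ
exp(D)ℓ, degree by degree in α (`family_twist_succ`). (3) The element κ has no inputs, so [κ, -] = 0
and [X, κ] = D_κ X. Therefore L = κ + exp(D)ℓ satisfies [L, L] = [exp(D)ℓ, exp(D)ℓ] + D_κ exp(D)ℓ =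
-dL, using dκ = 0. The added curvature term κ is precisely what compensates for dα = κ. The series
make sense only in the completion, so the identity is checked for partial sums modulo F_m. Since d
may remove one α, the partial sum with m + 1 terms is needed on the side of the differential
(`linfD_twistedPartial_sub_mem`). -/

namespace SymOp

open Equiv

/-! ### Inserting operations of arity 0 into symmetric families -/

section Brackets

variable {K : Type u} [Field K] {P : GradedOperad K}

/-- Since y has no inputs, a permutation of the inputs of x amounts to the input that receives y
together with a permutation of the N others. Each pair occurs exactly once, so the identity holds
without a further symmetrization and without factorials. -/
theorem GradedOperad.comp_sym_zero {N : ℕ} {a b c : ℤ} (h' : a + b = c) (x : P.obj (N + 1) a)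
    (y : P.obj 0 b) :
    P.comp (r := N) (show N + 1 + 0 = N + 1 from rfl) h' 0 (P.sym x) y =
      ∑ i, P.sym (P.comp (r := N) (show N + 1 + 0 = N + 1 from rfl) h' i x y) := by
  have e : ∀ σ : Perm (Fin (N + 1)),
      P.comp (r := N) (show N + 1 + 0 = N + 1 from rfl) h' 0 (P.act σ x) y =
      P.act (blockPerm (show N + 1 + 0 = N + 1 from rfl) 0 σ 1)
        (P.comp (r := N) (show N + 1 + 0 = N + 1 from rfl) h' (σ 0) x y) := by
    intro σ
    have := P.comp_act (show N + 1 + 0 = N + 1 from rfl) h' 0 σ 1 x y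
    rwa [P.act_one] at this
  let f : Perm (Fin (N + 1)) → Fin (N + 1) × Perm (Fin N) := fun σ =>
    (σ 0, blockPerm (show N + 1 + 0 = N + 1 from rfl) 0 σ 1)
  have hf : Function.Bijective f := by
    rw [Fintype.bijective_iff_injective_and_card]
    -- The block permutation records σ away from 0, with target numbered by `glue` at σ 0. Once σ 0
    -- = τ 0 the two numberings agree, and injectivity of `glue` recovers the remaining values.
    refine ⟨fun σ τ hστ => ?_, by
      simp [Fintype.card_perm, Nat.factorial_succ]⟩
    obtain ⟨h0, h1⟩ := Prod.mk.inj hστ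
    ext1 j
    by_cases hj : j = 0
    · rw [hj, h0]
    · have h2 := congrArg (fun ρ : Perm (Fin N) =>
        ρ (glue (show N + 1 + 0 = N + 1 from rfl) 0 (.inl ⟨j, hj⟩))) h1
      simp only [blockPerm_inl] at h2
      have hτ : τ j ≠ σ 0 := by rw [h0]; simpa using hj
      rw [glue_inl_congr _ h0.symm (τ j) (by simpa using hj) hτ] at h2
      simpa using (glue _ _).injective h2
  simp only [P.sym_apply, map_sum, LinearMap.sum_apply, e]
  rw [← Fintype.sum_prod_type' (f := fun i τ => P.act τ
    (P.comp (r := N) (show N + 1 + 0 = N + 1 from rfl) h' i x y))]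
  exact hf.sum_comp (fun iτ => P.act iτ.2
    (P.comp (r := N) (show N + 1 + 0 = N + 1 from rfl) h' iτ.1 x y))

theorem GradedOperad.isSym_zero_ary {b : ℤ} (y : P.obj 0 b) : P.IsSym y := fun σ => by
  rw [Subsingleton.elim σ 1, P.act_one]

/-- The family `X_{n+1} ∘_0 y` for a family of operations `X_n` and `y` of arity `0`. -/
def feed {a b c : ℤ} (h' : a + b = c) (y : P.obj 0 b) (X : ∀ n, P.obj n a) (n : ℕ) : P.obj n c :=
  P.comp (show n + 1 + 0 = n + 1 from rfl) h' 0 (X (n + 1)) y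

section

variable {a b c : ℤ} {X : ∀ n, P.obj n a}

/-- The block of inputs of y is empty, so every permutation preserves it and `IsSym.act_comp`
applies to all of them. -/
theorem isSym_feed (h' : a + b = c) (y : P.obj 0 b) (hX : ∀ n, P.IsSym (X n)) (n : ℕ) :
    P.IsSym (feed h' y X n) := fun σ =>
  (hX (n + 1)).act_comp _ h' (P.isSym_zero_ary y) (mem_blockPerms.2 (by simp))

/-- Changing the input of a symmetric operation changes the composite by a permutation, and the
composite with y is itself symmetric. Hence any input may serve as the one that receives y. -/
theorem comp_eq_feed (h' : a + b = c) (y : P.obj 0 b) (hX : ∀ n, P.IsSym (X n)) {n : ℕ}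
    (h : n + 1 + 0 = n + 1) (i : Fin (n + 1)) : P.comp h h' i (X (n + 1)) y = feed h' y X n := by
  obtain ⟨ρ, hρ⟩ := (hX (n + 1)).exists_comp h h' i 0 y
  exact hρ.trans (isSym_feed h' y hX n ρ)

/-- This is the axiom of parallel composition: the two inserted elements occupy different inputs of
X, so exchanging them costs only the Koszul sign. -/
theorem feed_feed {e f g : ℤ} (k₁ : a + b = e) (k₂ : e + c = f) (k₃ : a + c = g) (k₄ : g + b = f)
    (y : P.obj 0 b) (z : P.obj 0 c) (hX : ∀ n, P.IsSym (X n)) :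
    feed k₂ z (feed k₁ y X) = ksign K (b * c) • feed k₄ y (feed k₃ z X) := by
  funext n
  change P.comp _ k₂ 0 (P.comp _ k₁ 0 (X (n + 1 + 1)) y) z =
    ksign K (b * c) • P.comp _ k₄ 0 (feed k₃ z X (n + 1)) y
  -- `comp_comm` needs two distinct inputs of X, so z is moved to input 1; after y has filled input
  -- 0, that input is again numbered 0.
  rw [← comp_eq_feed k₃ z hX rfl 1]
  exact P.comp_comm (l := n + 1 + 1) (m := 0) (n := 0) (s := n + 1) (t := n) (v := n + 1) rfl rfl
    rfl rfl k₁ k₂ k₃ k₄ 0 1 0 0 (by simp) rfl (by simp) _ _ _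

theorem feed_smul (h' : a + b = c) (y : P.obj 0 b) (k : K) (X : ∀ n, P.obj n a) :
    feed h' y (k • X) = k • feed h' y X := by
  funext n; simp [feed]

theorem feed_neg (h' : a + b = c) (y : P.obj 0 b) (X : ∀ n, P.obj n a) :
    feed h' y (-X) = - feed h' y X := by
  funext n; simp [feed]

theorem feed_sub (h' : a + b = c) (y : P.obj 0 b) (X Y : ∀ n, P.obj n a) :
    feed h' y (X - Y) = feed h' y X - feed h' y Y := by
  funext n; simp [feed]

theorem feed_sum {ι : Type*} (s : Finset ι) (h' : a + b = c) (y : P.obj 0 b)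
    (X : ι → ∀ n, P.obj n a) : feed h' y (∑ i ∈ s, X i) = ∑ i ∈ s, feed h' y (X i) := by
  funext n; simp [feed]

end

/-! ### The bracket of families and its derivations -/

/-- The symmetrization of `X_{p+1} ∘_0 Y_q` for `p + q = n`. -/
def symComp {a b c : ℤ} (h' : a + b = c) (X : ∀ n, P.obj n a) (Y : ∀ n, P.obj n b) (n p q : ℕ) :
    P.obj n c :=
  if h : p + q = n then
    P.sym (P.comp (show p + 1 + q = n + 1 by omega) h' 0 (X (p + 1)) (Y q))
  else 0

/-- The family `∑_{p + q = n} sym (X_{p+1} ∘_0 Y_q) / (p! q!)`. -/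
def bracket {a b c : ℤ} (h' : a + b = c) (X : ∀ n, P.obj n a) (Y : ∀ n, P.obj n b) (n : ℕ) :
    P.obj n c :=
  ∑ pq ∈ Finset.HasAntidiagonal.antidiagonal n,
    (pq.1.factorial * pq.2.factorial : K)⁻¹ • symComp h' X Y n pq.1 pq.2

theorem linfD_eq_bracket [CharZero K] {l : ∀ n, P.obj n (-1)} (hl : ∀ n, P.IsSym (l n)) (n : ℕ) :
    linfD P l n = - bracket (show (-1 : ℤ) + -1 = -1 - 1 by norm_num) l l n :=
  linfD_eq hl n

variable {a b c : ℤ} (h' : a + b = c)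

theorem bracket_add_left (X X' : ∀ n, P.obj n a) (Y : ∀ n, P.obj n b) :
    bracket h' (X + X') Y = bracket h' X Y + bracket h' X' Y := by
  funext n
  simp only [bracket, Pi.add_apply, ← Finset.sum_add_distrib, ← smul_add]
  refine Finset.sum_congr rfl fun pq _ => ?_
  congr 1
  simp only [symComp]
  split_ifs <;> simp

theorem bracket_add_right (X : ∀ n, P.obj n a) (Y Y' : ∀ n, P.obj n b) :
    bracket h' X (Y + Y') = bracket h' X Y + bracket h' X Y' := by
  funext n
  simp only [bracket, Pi.add_apply, ← Finset.sum_add_distrib, ← smul_add]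
  refine Finset.sum_congr rfl fun pq _ => ?_
  congr 1
  simp only [symComp]
  split_ifs <;> simp

theorem bracket_smul_left (k : K) (X : ∀ n, P.obj n a) (Y : ∀ n, P.obj n b) :
    bracket h' (k • X) Y = k • bracket h' X Y := by
  funext n
  simp only [bracket, Pi.smul_apply, Finset.smul_sum]
  refine Finset.sum_congr rfl fun pq _ => ?_
  rw [smul_comm k]
  congr 1
  simp only [symComp]
  split_ifs <;> simp

theorem bracket_smul_right (k : K) (X : ∀ n, P.obj n a) (Y : ∀ n, P.obj n b) :
    bracket h' X (k • Y) = k • bracket h' X Y := by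
  funext n
  simp only [bracket, Pi.smul_apply, Finset.smul_sum]
  refine Finset.sum_congr rfl fun pq _ => ?_
  rw [smul_comm k]
  congr 1
  simp only [symComp]
  split_ifs <;> simp

/-- The bracket as a bilinear map. -/
def bracketHom : (∀ n, P.obj n a) →ₗ[K] (∀ n, P.obj n b) →ₗ[K] (∀ n, P.obj n c) :=
  LinearMap.mk₂ K (bracket h') (bracket_add_left h') (bracket_smul_left h')
    (bracket_add_right h') (bracket_smul_right h')

variable {X : ∀ n, P.obj n a} {Y : ∀ n, P.obj n b}

/-- Of the n + 1 inputs of X_{p+1} ∘_0 Y_q, the first q belong to Y and the other p to X. By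
symmetry, all insertions of α into inputs of the same kind give the same result. When q = 0 or p =
0, the truncated index is harmless because its coefficient is zero. -/
theorem symComp_feed (α : P.obj 0 0) (hX : ∀ n, P.IsSym (X n)) (hY : ∀ n, P.IsSym (Y n))
    {n p q : ℕ} (h : p + q = n + 1) :
    P.comp (r := n) (show n + 1 + 0 = n + 1 from rfl) (add_zero c) 0
      (symComp h' X Y (n + 1) p q) α =
    (q : K) • symComp h' X (feed (add_zero b) α Y) n p (q - 1) +
      (p : K) • symComp h' (feed (add_zero a) α X) Y n (p - 1) q := by
  have key : ∀ i : Fin (n + 1), P.sym (P.comp (r := n) (show n + 1 + 0 = n + 1 from rfl)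
      (add_zero c) i (P.comp (r := n + 1) (show p + 1 + q = n + 1 + 1 by omega) h' 0 (X (p + 1))
        (Y q)) α) = if (i : ℕ) < q then symComp h' X (feed (add_zero b) α Y) n p (q - 1) else
      symComp h' (feed (add_zero a) α X) Y n (p - 1) q := by
    intro i
    split_ifs with hi
    · obtain ⟨q, rfl⟩ : ∃ q', q = q' + 1 := ⟨q - 1, by omega⟩
      rw [P.comp_assoc _ _ (show q + 1 + 0 = q + 1 from rfl) (show p + 1 + q = n + 1 by omega) _ _
        (add_zero b) h' 0 ⟨i, hi⟩ i (by simp), comp_eq_feed _ _ hY, symComp, dif_pos (by omega)]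
      rfl
    · obtain ⟨p, rfl⟩ : ∃ p', p = p' + 1 := ⟨p - 1, by omega⟩
      -- The input i ≥ q of the composite is the input i - q + 1 of X. As α has degree 0, exchanging
      -- it with Y gives no sign.
      rw [P.comp_comm _ _ (show p + 1 + 1 + 0 = p + 1 + 1 from rfl)
        (show p + 1 + q = n + 1 by omega) _ _ (add_zero a) h' 0 ⟨i - q + 1, by omega⟩ 0 i
        (by simp [Fin.lt_def]) rfl (by simp only; omega), comp_eq_feed _ _ hX, mul_zero, ksign_zero,
        one_smul, symComp, dif_pos (by omega)]
      rfl
  rw [symComp, dif_pos h, P.comp_sym_zero, Finset.sum_congr rfl fun i _ => key i, Finset.sum_ite,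
    Finset.sum_const, Finset.sum_const, ← Nat.cast_smul_eq_nsmul K, ← Nat.cast_smul_eq_nsmul K]
  have c1 : (Finset.univ.filter fun i : Fin (n + 1) => (i : ℕ) < q).card = q := by
    have := Fin.card_filter_val_lt (n := n + 1) (m := q)
    omega
  have c2 : (Finset.univ.filter fun i : Fin (n + 1) => ¬ (i : ℕ) < q).card = p := by
    have := Finset.card_filter_add_card_filter_not (s := Finset.univ)
      (fun i : Fin (n + 1) => (i : ℕ) < q)
    rw [c1, Finset.card_univ, Fintype.card_fin] at this
    omega
  rw [c1, c2]

theorem inv_factorial_succ_mul [CharZero K] (k : ℕ) :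
    ((k + 1).factorial : K)⁻¹ * (k + 1 : ℕ) = (k.factorial : K)⁻¹ := by
  have h1 : ((k + 1 : ℕ) : K) ≠ 0 := by exact_mod_cast Nat.succ_ne_zero k
  have h2 : (k.factorial : K) ≠ 0 := by exact_mod_cast k.factorial_ne_zero
  rw [Nat.factorial_succ, Nat.cast_mul]
  field_simp

/-- Inserting an operation of arity and degree `0` is a derivation of the bracket. -/
theorem feed_bracket [CharZero K] (α : P.obj 0 0) (hX : ∀ n, P.IsSym (X n))
    (hY : ∀ n, P.IsSym (Y n)) :
    feed (add_zero c) α (bracket h' X Y) =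
      bracket h' (feed (add_zero a) α X) Y + bracket h' X (feed (add_zero b) α Y) := by
  funext n
  have e : ∀ pq ∈ Finset.HasAntidiagonal.antidiagonal (n + 1),
      P.comp (r := n) (show n + 1 + 0 = n + 1 from rfl) (add_zero c) 0
        ((pq.1.factorial * pq.2.factorial : K)⁻¹ • symComp h' X Y (n + 1) pq.1 pq.2) α =
      (pq.1.factorial * pq.2.factorial : K)⁻¹ •
        (pq.2 : K) • symComp h' X (feed (add_zero b) α Y) n pq.1 (pq.2 - 1) +
      (pq.1.factorial * pq.2.factorial : K)⁻¹ •
        (pq.1 : K) • symComp h' (feed (add_zero a) α X) Y n (pq.1 - 1) pq.2 := by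
    intro pq hpq
    rw [Finset.HasAntidiagonal.mem_antidiagonal] at hpq
    rw [map_smul, LinearMap.smul_apply, symComp_feed h' α hX hY hpq, smul_add]
  -- In the first sum the term with q = 0 has coefficient zero, in the second the term with p = 0.
  -- Splitting these off reindexes both sums over p + q = n, and q / q! = 1 / (q - 1)!, respectively
  -- p / p! = 1 / (p - 1)!, restores the normalization.
  rw [Pi.add_apply, feed, bracket, map_sum, LinearMap.sum_apply, Finset.sum_congr rfl e,
    Finset.sum_add_distrib, Finset.Nat.sum_antidiagonal_succ', Finset.Nat.sum_antidiagonal_succ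
      (n := n) (f := fun pq => (pq.1.factorial * pq.2.factorial : K)⁻¹ •
        (pq.1 : K) • symComp h' (feed (add_zero a) α X) Y n (pq.1 - 1) pq.2)]
  simp only [Nat.cast_zero, zero_smul, smul_zero, zero_add, Nat.add_sub_cancel]
  rw [add_comm]
  congr 1
  · refine Finset.sum_congr rfl fun pq _ => ?_
    rw [smul_smul, mul_inv, mul_right_comm, inv_factorial_succ_mul, ← mul_inv]
  · refine Finset.sum_congr rfl fun pq _ => ?_
    rw [smul_smul, mul_inv, mul_assoc, inv_factorial_succ_mul, ← mul_inv]

/-- The bracket with a family concentrated in arity `0`. -/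
theorem bracket_of_eq_zero [CharZero K] (hX : ∀ n, P.IsSym (X n)) (hY : ∀ n, n ≠ 0 → Y n = 0) :
    bracket h' X Y = feed h' (Y 0) X := by
  funext n
  have hn : (n.factorial : K) ≠ 0 := by exact_mod_cast n.factorial_ne_zero
  rw [bracket, Finset.sum_eq_single (n, 0)]
  -- The surviving term symmetrizes an operation that is already symmetric. This multiplies it by
  -- n!, which cancels the coefficient.
  · rw [symComp, dif_pos (add_zero n)]
    change _ • P.sym (feed h' (Y 0) X n) = _
    rw [P.sym_apply, Finset.sum_congr rfl fun σ _ => isSym_feed h' (Y 0) hX n σ, Finset.sum_const,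
      Finset.card_univ, Fintype.card_perm, Fintype.card_fin, ← Nat.cast_smul_eq_nsmul K, smul_smul,
      Nat.factorial_zero, Nat.cast_one, mul_one, inv_mul_cancel₀ hn, one_smul]
  · rintro ⟨p, q⟩ hpq hne
    rw [Finset.HasAntidiagonal.mem_antidiagonal] at hpq
    have hq : q ≠ 0 := by rintro rfl; exact hne (by simpa using hpq)
    simp [symComp, hY q hq]
  · simp

/-- The left argument enters only through its members X_{p+1}, which have an input to receive Y.
This yields [κ, -] = 0. -/
theorem bracket_eq_zero (hX : ∀ n, X (n + 1) = 0) : bracket h' X Y = 0 := by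
  funext n
  simp [bracket, symComp, hX]

end Brackets

/-! ### The exponential of the insertion of α and its differential -/

section Twist

variable {K : Type u} [Field K] {P : GradedOperad K}

/-- The families `X_{n+k}(α^k, -) / k!`. -/
def twist {a : ℤ} (α : P.obj 0 0) (X : ∀ n, P.obj n a) (k : ℕ) : ∀ n, P.obj n a :=
  (k.factorial : K)⁻¹ • (feed (add_zero a) α)^[k] X

/-- The component of degree `k` in `α` of the bracket of the series `∑_k twist α X k` with
itself. -/
def twistBracket {a b : ℤ} (h : a + a = b) (α : P.obj 0 0) (X : ∀ n, P.obj n a) (k : ℕ) :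
    ∀ n, P.obj n b :=
  ∑ ij ∈ Finset.HasAntidiagonal.antidiagonal k, bracket h (twist α X ij.1) (twist α X ij.2)

/-- A derivation applied to all members of a family. -/
def Derivation.family (d : Derivation P) {a : ℤ} :
    (∀ n, P.obj n a) →ₗ[K] (∀ n, P.obj n (a - 1)) where
  toFun X n := d.toFun (X n)
  map_add' X Y := by funext n; simp
  map_smul' k X := by funext n; simp

variable {a b : ℤ} (α : P.obj 0 0) {X : ∀ n, P.obj n a}

theorem twist_zero : twist α X 0 = X := by simp [twist]

theorem isSym_twist (hX : ∀ n, P.IsSym (X n)) (k n : ℕ) : P.IsSym (twist α X k n) := by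
  have h : ∀ n, P.IsSym ((feed (add_zero a) α)^[k] X n) := by
    induction k with
    | zero => exact hX
    | succ k ih =>
        rw [Function.iterate_succ_apply']
        exact isSym_feed _ _ ih
  intro σ
  rw [twist, Pi.smul_apply, map_smul, h n σ]

/-- This is D (D^k / k!) = (k + 1) D^{k+1} / (k + 1)!, the recursion that characterizes the
components of exp(D). -/
theorem feed_twist [CharZero K] (k : ℕ) :
    feed (add_zero a) α (twist α X k) = ((k + 1 : ℕ) : K) • twist α X (k + 1) := by
  rw [twist, feed_smul, twist, smul_smul, mul_comm, inv_factorial_succ_mul,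
    Function.iterate_succ_apply']

/-- The exponential of a derivation is multiplicative: the components of [exp(D)X, exp(D)X] satisfy
the recursion of `feed_twist`. By the Leibniz rule, [X_i, X_j] with i + j = k + 1 arises with
coefficient i from the left factor and j from the right one, in total k + 1. -/
theorem feed_twistBracket [CharZero K] (h : a + a = b) (hX : ∀ n, P.IsSym (X n)) (k : ℕ) :
    feed (add_zero b) α (twistBracket h α X k) =
      ((k + 1 : ℕ) : K) • twistBracket h α X (k + 1) := by
  have e : ∀ ij ∈ Finset.HasAntidiagonal.antidiagonal k,
      feed (add_zero b) α (bracket h (twist α X ij.1) (twist α X ij.2)) =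
      ((ij.1 + 1 : ℕ) : K) • bracket h (twist α X (ij.1 + 1)) (twist α X ij.2) +
      ((ij.2 + 1 : ℕ) : K) • bracket h (twist α X ij.1) (twist α X (ij.2 + 1)) := by
    intro ij _
    rw [feed_bracket h α (isSym_twist α hX _) (isSym_twist α hX _), feed_twist, feed_twist,
      bracket_smul_left, bracket_smul_right]
  have e' : ∀ ij ∈ Finset.HasAntidiagonal.antidiagonal (k + 1),
      ((k + 1 : ℕ) : K) • bracket h (twist α X ij.1) (twist α X ij.2) =
      (ij.1 : K) • bracket h (twist α X ij.1) (twist α X ij.2) +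
      (ij.2 : K) • bracket h (twist α X ij.1) (twist α X ij.2) := by
    intro ij hij
    rw [← Finset.HasAntidiagonal.mem_antidiagonal.1 hij, Nat.cast_add, add_smul]
  rw [twistBracket, twistBracket, feed_sum, Finset.sum_congr rfl e, Finset.smul_sum,
    Finset.sum_congr rfl e', Finset.sum_add_distrib, Finset.sum_add_distrib,
    Finset.Nat.sum_antidiagonal_succ (f := fun ij =>
      (ij.1 : K) • bracket h (twist α X ij.1) (twist α X ij.2)),
    Finset.Nat.sum_antidiagonal_succ' (f := fun ij =>
      (ij.2 : K) • bracket h (twist α X ij.1) (twist α X ij.2))]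
  simp only [Nat.cast_zero, zero_smul, zero_add]

variable (d : Derivation P)

theorem family_feed {b c : ℤ} (h' : a + b = c) (y : P.obj 0 b) (X : ∀ n, P.obj n a) :
    d.family (feed h' y X) = feed (show a - 1 + b = c - 1 by omega) y (d.family X) +
      ksign K a • feed (show a + (b - 1) = c - 1 by omega) (d.toFun y) X := by
  funext n
  exact d.map_comp _ h' 0 _ _

/-- The differential commutes with D up to the insertion of dα, which appears with a minus sign as X
has degree -1. Since that insertion commutes with D, the k + 1 ways of hitting one of the α in
D^{k+1} X / (k + 1)! all agree, leaving D^k X / k! with dα inserted. -/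
theorem family_twist_succ [CharZero K] {X : ∀ n, P.obj n (-1)} (hX : ∀ n, P.IsSym (X n))
    (hd : d.family X = - bracket (show (-1 : ℤ) + -1 = -1 - 1 by norm_num) X X) (k : ℕ) :
    d.family (twist α X (k + 1)) =
      - twistBracket (show (-1 : ℤ) + -1 = -1 - 1 by norm_num) α X (k + 1) -
        feed (show (-1 : ℤ) + (0 - 1) = -1 - 1 by norm_num) (d.toFun α) (twist α X k) := by
  have hs : ksign K (-1) = -1 := by simp [ksign]
  have hne : ∀ k : ℕ, ((k + 1 : ℕ) : K) ≠ 0 := fun k => by exact_mod_cast Nat.succ_ne_zero k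
  have step : ∀ k, ((k + 1 : ℕ) : K) • d.family (twist α X (k + 1)) =
      feed (add_zero _) α (d.family (twist α X k)) -
        feed (show (-1 : ℤ) + (0 - 1) = -1 - 1 by norm_num) (d.toFun α) (twist α X k) := by
    intro k
    rw [← map_smul, ← feed_twist, family_feed, hs, neg_smul, one_smul]
    exact (sub_eq_add_neg _ _).symm
  -- Multiplied by k + 1, the left side is governed by the recursion `step`, which involves no
  -- inverse factorials.
  refine smul_right_injective _ (hne k) ?_
  dsimp only
  rw [step]
  induction k with
  | zero =>
      have h0 : d.family X =
          - twistBracket (show (-1 : ℤ) + -1 = -1 - 1 by norm_num) α X 0 := by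
        simp [hd, twistBracket, twist_zero]
      rw [twist_zero, h0, feed_neg, feed_twistBracket α _ hX]
      simp
  | succ k ih =>
      -- The hypothesis regains the form of a multiple of k + 1, which can be cancelled. Applying D
      -- then gives k + 1 copies of the insertion of dα into `twist α X (k + 1)`, and `step`
      -- contributes one more.
      rw [← step] at ih
      rw [smul_right_injective _ (hne k) ih, feed_sub, feed_neg,
        feed_twistBracket α _ hX, feed_feed _ _ (add_zero (-1))
          (show (-1 : ℤ) + (0 - 1) = -1 - 1 by norm_num) _ _ (isSym_twist α hX k), mul_zero,
        ksign_zero, one_smul, feed_twist, feed_smul, smul_sub, smul_neg,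
        Nat.cast_succ (k + 1), add_smul (_ : K) 1 (feed _ _ _), one_smul]
      abel

theorem family_twist_zero {X : ∀ n, P.obj n (-1)}
    (hd : d.family X = - bracket (show (-1 : ℤ) + -1 = -1 - 1 by norm_num) X X) :
    d.family (twist α X 0) =
      - twistBracket (show (-1 : ℤ) + -1 = -1 - 1 by norm_num) α X 0 := by
  simp [hd, twistBracket, twist_zero]

end Twist

/-! ### The universal property of operads given by generators and relations -/

section Presented

variable {K : Type u} [Field K] {G : ℕ → ℤ → Type u}
  {R : ∀ n a, Term K G n a → Term K G n a → Prop} {Q : GradedOperad K}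

/-- The value of a formal expression in a graded operad. -/
def Term.eval (v : ∀ n a, G n a → Q.obj n a) : ∀ {n : ℕ} {a : ℤ}, Term K G n a → Q.obj n a
  | _, _, .gen g => v _ _ g
  | _, _, .zero => 0
  | _, _, .add x y => x.eval v + y.eval v
  | _, _, .smul k x => k • x.eval v
  | _, _, .act σ x => Q.act σ (x.eval v)
  | _, _, .one => Q.one
  | _, _, .comp h h' i x y => Q.comp h h' i (x.eval v) (y.eval v)

theorem Term.eval_rel (v : ∀ n a, G n a → Q.obj n a)
    (hv : ∀ n a x y, R n a x y → x.eval v = y.eval v)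
    {n : ℕ} {a : ℤ} {x y : Term K G n a} (h : Rel R x y) : x.eval v = y.eval v := by
  induction h with
  | of h => exact hv _ _ _ _ h
  | refl x => rfl
  | symm _ ih => exact ih.symm
  | trans _ _ ih₁ ih₂ => exact ih₁.trans ih₂
  | add_congr _ _ ih₁ ih₂ => simp only [Term.eval, ih₁, ih₂]
  | smul_congr k _ ih => simp only [Term.eval, ih]
  | act_congr σ _ ih => simp only [Term.eval, ih]
  | comp_congr h h' i _ _ ih₁ ih₂ => simp only [Term.eval, ih₁, ih₂]
  | add_assoc x y z => exact add_assoc _ _ _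
  | add_comm x y => exact add_comm _ _
  | zero_add x => exact zero_add _
  | one_smul x => exact one_smul _ _
  | zero_smul x => exact zero_smul _ _
  | mul_smul k l x => exact mul_smul _ _ _
  | add_smul k l x => exact add_smul _ _ _
  | smul_add k x y => exact smul_add _ _ _
  | act_add σ x y => exact map_add _ _ _
  | act_smul σ k x => exact map_smul _ _ _
  | add_comp h h' i x y z => exact LinearMap.map_add₂ _ _ _ _
  | smul_comp h h' i k x z => exact LinearMap.map_smul₂ _ _ _ _
  | comp_add h h' i x y z => exact map_add _ _ _
  | comp_smul h h' i k x z => exact map_smul _ _ _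
  | act_one x => exact Q.act_one _
  | act_mul σ τ x => exact Q.act_mul _ _ _
  | one_comp h h' i x => exact Q.one_comp _ _ _ _
  | comp_one h h' i x => exact Q.comp_one _ _ _ _
  | comp_assoc h₁ h₂ h₃ h₄ k₁ k₂ k₃ k₄ i j k hk x y z =>
      exact Q.comp_assoc h₁ h₂ h₃ h₄ k₁ k₂ k₃ k₄ i j k hk _ _ _
  | comp_comm h₁ h₂ h₃ h₄ k₁ k₂ k₃ k₄ i k i' k' hik hi hk x y z =>
      exact Q.comp_comm h₁ h₂ h₃ h₄ k₁ k₂ k₃ k₄ i k i' k' hik hi hk _ _ _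
  | comp_act h h' i σ τ x y => exact Q.comp_act h h' i σ τ _ _

/-- The linear maps induced by the evaluation of formal expressions. -/
def presentedEval (v : ∀ n a, G n a → Q.obj n a)
    (hv : ∀ n a x y, R n a x y → x.eval v = y.eval v) {n : ℕ} {a : ℤ} :
    (presented R).obj n a →ₗ[K] Q.obj n a where
  toFun := Quotient.lift (Term.eval v) fun _ _ h => Term.eval_rel v hv h
  map_add' := by rintro ⟨x⟩ ⟨y⟩; rfl
  map_smul' := by rintro k ⟨x⟩; rfl

/-- The morphism from a dg operad with generators `G` and relations `R` that has given values on the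
generators. -/
def presentedHom {D : ∀ n a, G n a → (presented R).obj n (a - 1)}
    {hD : ∀ n a x y, R n a x y → x.der D = y.der D}
    {hDD : ∀ n a (g : G n a), (presentedDer D hD).toFun (D n a g) = 0} {Q : DGOperad K}
    (v : ∀ n a, G n a → Q.op.obj n a) (hv : ∀ n a x y, R n a x y → x.eval v = y.eval v)
    (hvd : ∀ n a (g : G n a), presentedEval v hv (D n a g) = Q.d.toFun (v n a g)) :
    (presentedDG R D hD hDD).Hom Q where
  toFun := presentedEval v hv
  map_one := rfl
  map_act := by rintro n a σ ⟨x⟩; rfl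
  map_comp := by rintro m n r a b c h h' i ⟨x⟩ ⟨y⟩; rfl
  map_d := by
    suffices H : ∀ {n : ℕ} {a : ℤ} (w : Term K G n a),
        presentedEval v hv (w.der D) = Q.d.toFun (w.eval v) by
      rintro n a ⟨w⟩
      exact H w
    intro n a w
    induction w with
    | gen g => exact hvd _ _ g
    | zero => exact (map_zero _).trans (map_zero _).symm
    | add x y hx hy =>
        rw [Term.der, map_add, hx, hy, Term.eval, map_add]
    | smul k x hx => rw [Term.der, map_smul, hx, Term.eval, map_smul]
    | act σ x hx =>
        rw [Term.eval, Q.d.map_act, ← hx]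
        -- The derivative of an expression is a class, not an expression; on a representative, the
        -- compatibility of the evaluation with the action holds by definition. The case of a
        -- composite is treated in the same way.
        obtain ⟨y, hy⟩ := Quotient.exists_rep (x.der D)
        rw [Term.der, ← hy]
        rfl
    | one => exact (map_zero _).trans Q.d.map_one.symm
    | comp h h' i x y hx hy =>
        rw [Term.eval, Q.d.map_comp, ← hx, ← hy]
        obtain ⟨x', hx'⟩ := Quotient.exists_rep (x.der D)
        obtain ⟨y', hy'⟩ := Quotient.exists_rep (y.der D)
        rw [Term.der, ← hx', ← hy']
        rfl

/-- Morphisms from a dg operad with generators `G` are determined by their values on `G`. -/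
theorem presentedHom_ext {D : ∀ n a, G n a → (presented R).obj n (a - 1)}
    {hD : ∀ n a x y, R n a x y → x.der D = y.der D}
    {hDD : ∀ n a (g : G n a), (presentedDer D hD).toFun (D n a g) = 0} {Q : DGOperad K}
    {φ ψ : (presentedDG R D hD hDD).Hom Q}
    (h : ∀ n a (g : G n a), φ.toFun (gen (R := R) g) = ψ.toFun (gen (R := R) g)) : φ = ψ := by
  suffices H : ∀ {n : ℕ} {a : ℤ} (w : Term K G n a),
      φ.toFun (cls (R := R) w) = ψ.toFun (cls (R := R) w) by
    -- The remaining fields of a morphism are propositions, so equality of the underlying maps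
    -- suffices.
    have : @DGOperad.Hom.toFun _ _ _ _ φ = @DGOperad.Hom.toFun _ _ _ _ ψ := by
      funext n a
      refine LinearMap.ext ?_
      rintro ⟨w⟩
      exact H w
    cases φ
    cases ψ
    congr
  intro n a w
  induction w with
  | gen g => exact h _ _ g
  | zero => exact (map_zero φ.toFun).trans (map_zero ψ.toFun).symm
  | add x y hx hy =>
      exact (map_add φ.toFun (cls x) (cls y)).trans
        ((congrArg₂ (· + ·) hx hy).trans (map_add ψ.toFun (cls x) (cls y)).symm)
  | smul k x hx =>
      exact (map_smul φ.toFun k (cls x)).trans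
        ((congrArg (k • ·) hx).trans (map_smul ψ.toFun k (cls x)).symm)
  | act σ x hx =>
      exact (φ.map_act σ (cls x)).trans
        ((congrArg (Q.op.act σ) hx).trans (ψ.map_act σ (cls x)).symm)
  | one => exact φ.map_one.trans ψ.map_one.symm
  | comp h h' i x y hx hy =>
      exact (φ.map_comp h h' i (cls x) (cls y)).trans
        ((congrArg₂ (fun u v => Q.op.comp h h' i u v) hx hy).trans
          (ψ.map_comp h h' i (cls x) (cls y)).symm)

end Presented

/-! ### Naturality of the differential's formula -/

section LinfD

variable {K : Type u} [Field K] {P Q : GradedOperad K}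

theorem map_linfD (φ : ∀ {n : ℕ} {a : ℤ}, P.obj n a →ₗ[K] Q.obj n a)
    (hact : ∀ {n : ℕ} {a : ℤ} (σ : Perm (Fin n)) (x : P.obj n a),
      φ (P.act σ x) = Q.act σ (φ x))
    (hcomp : ∀ {m n r : ℕ} {a b c : ℤ} (h : m + n = r + 1) (h' : a + b = c) (i : Fin m)
      (x : P.obj m a) (y : P.obj n b), φ (P.comp h h' i x y) = Q.comp h h' i (φ x) (φ y))
    (l : ∀ n, P.obj n (-1)) (n : ℕ) : φ (linfD P l n) = linfD Q (fun k => φ (l k)) n := by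
  simp only [linfD, map_neg, map_sum, hact, hcomp]

/-- Actions and compositions in the completion are defined componentwise on the quotients P / F_m.
The formula can therefore be computed there on arbitrary representatives, which reduces the equation
for infinite series to one for finite sums modulo F_m. -/
theorem Filtration.linfD_apply {P : DGOperad K} (F : Filtration P)
    (l : ∀ n, F.completed.op.obj n (-1)) (l' : ∀ n, P.op.obj n (-1)) (m : ℕ)
    (hl : ∀ n, (show F.completion n (-1) from l n).1 m = Submodule.Quotient.mk (l' n)) (n : ℕ) :
    (show F.completion n (-1 - 1) from linfD F.completed.op l n).1 m =
      Submodule.Quotient.mk (linfD P.op l' n) := by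
  let π : F.completion n (-1 - 1) →ₗ[K] (P.op.obj n (-1 - 1) ⧸ F.F m n (-1 - 1)) :=
    (LinearMap.proj m).comp (Submodule.subtype _)
  change π (linfD F.completed.op l n) = (F.F m n (-1 - 1)).mkQ (linfD P.op l' n)
  rw [linfD, linfD, map_neg]
  refine (map_neg π _).trans (congrArg _ ?_)
  refine (map_sum π _ _).trans ((Finset.sum_congr rfl fun pq _ => ?_).trans (map_sum _ _ _).symm)
  refine (map_sum π _ _).trans ((Finset.sum_congr rfl fun σ _ => ?_).trans (map_sum _ _ _).symm)
  change F.qAct m σ (F.qComp m _ _ 0 ((show F.completion _ (-1) from l _).1 m)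
    ((show F.completion _ (-1) from l _).1 m)) = _
  rw [hl, hl]
  rfl

end LinfD

/-! ### The quadratic equation for the partial sums of the twisted operations -/

section TwistedMorphism

/-- The left side runs over the triangle i + j < m and the right side over the square i, j < m; the
difference consists of terms that vanish. It serves to compare the square of a truncated series with
the truncation of its square. -/
theorem sum_range_antidiagonal_eq {M : Type*} [AddCommMonoid M] (m : ℕ) (f : ℕ → ℕ → M)
    (hf : ∀ i j, m ≤ i + j → f i j = 0) :
    ∑ k ∈ Finset.range m, ∑ ij ∈ Finset.HasAntidiagonal.antidiagonal k, f ij.1 ij.2 =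
      ∑ i ∈ Finset.range m, ∑ j ∈ Finset.range m, f i j := by
  rw [Finset.sum_sigma', ← Finset.sum_product',
    ← Finset.sum_filter_of_ne (s := Finset.range m ×ˢ Finset.range m) (p := fun ij => ij.1 + ij.2 < m)
      (fun ij _ h => not_le.1 fun h' => h (hf _ _ h'))]
  refine Finset.sum_nbij' (fun z => z.2) (fun ij => ⟨ij.1 + ij.2, ij⟩) ?_ ?_ ?_ ?_ ?_
  · rintro ⟨k, i, j⟩ h
    simp only [Finset.mem_sigma, Finset.HasAntidiagonal.mem_antidiagonal, Finset.mem_range,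
      Finset.mem_filter, Finset.mem_product] at h ⊢
    omega
  · rintro ⟨i, j⟩ h
    exact Finset.mem_sigma.2 ⟨Finset.mem_range.2 (Finset.mem_filter.1 h).2,
      Finset.HasAntidiagonal.mem_antidiagonal.2 rfl⟩
  · rintro ⟨k, i, j⟩ h
    simp only [Finset.mem_sigma, Finset.HasAntidiagonal.mem_antidiagonal] at h
    simp [h.2]
  · rintro ⟨i, j⟩ _
    rfl
  · rintro ⟨k, i, j⟩ _
    rfl

variable {K : Type u} [Field K]

theorem Filtration.bracket_mem {P : DGOperad K} (F : Filtration P) {a b c : ℤ} (h' : a + b = c)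
    {k l : ℕ} {X : ∀ n, P.op.obj n a} {Y : ∀ n, P.op.obj n b} (hX : ∀ n, X n ∈ F.F k n a)
    (hY : ∀ n, Y n ∈ F.F l n b) (n : ℕ) : bracket h' X Y n ∈ F.F (k + l) n c := by
  refine Submodule.sum_mem _ fun pq _ => Submodule.smul_mem _ _ ?_
  rw [symComp]
  split_ifs
  · rw [P.op.sym_apply]
    exact Submodule.sum_mem _ fun σ _ => F.act_mem σ (F.comp_mem _ _ _ (hX _) (hY _))
  · exact Submodule.zero_mem _

theorem Filtration.le_of_le {P : DGOperad K} (F : Filtration P) {k l : ℕ} (h : k ≤ l) (n : ℕ)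
    (a : ℤ) : F.F l n a ≤ F.F k n a :=
  antitone_nat_of_succ_le (f := fun k => F.F k n a) (fun k => F.anti k n a) h

variable (K) [CharZero K]

/-- The operations `ℓ_n` of the coproduct of `cL_∞` and `T`. -/
def ellCoprod (n : ℕ) : (coprod (cLinf K) (T K)).op.obj n (-1) := inl (ell K n)

theorem isSym_ellCoprod (n : ℕ) : (coprod (cLinf K) (T K)).op.IsSym (ellCoprod K n) := fun σ =>
  (cls_sound (.of (.inl_act σ (ell K n)))).symm.trans (congrArg inl (isSym_lgen K n σ))

/-- The inclusion of `cLinf K` in the coproduct is compatible with the differentials and with all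
operations entering the formula. This is the hypothesis on X in `family_twist_succ`. -/
theorem family_ellCoprod : (coprod (cLinf K) (T K)).d.family (ellCoprod K) =
    - bracket (show (-1 : ℤ) + -1 = -1 - 1 by norm_num) (ellCoprod K) (ellCoprod K) := by
  funext n
  refine Eq.trans ?_ (linfD_eq_bracket (isSym_ellCoprod K) n)
  change inl (linfD (cLinf K).op (ell K) n) = _
  exact map_linfD (P := (cLinf K).op) (Q := (coprod (cLinf K) (T K)).op) inl
    (fun σ x => cls_sound (.of (.inl_act σ x)))
    (fun h h' i x y => cls_sound (.of (.inl_comp h h' i x y))) (ell K) n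

/-- `insertAlpha` performs the insertion at the highest arity first, which replaces X by `feed
(add_zero a) (alpha K) X`; hence the induction varies the family and not the arity. -/
theorem insertAlpha_eq {a : ℤ} (k : ℕ) (X : ∀ n, (coprod (cLinf K) (T K)).op.obj n a) (n : ℕ) :
    insertAlpha K k (X (n + k)) = (feed (add_zero a) (alpha K))^[k] X n := by
  induction k generalizing X with
  | zero => rfl
  | succ k ih => exact ih (feed (add_zero a) (alpha K) X)

theorem twistTerm_eq (n k : ℕ) : twistTerm K n k = twist (alpha K) (ellCoprod K) k n :=
  congrArg ((k.factorial : K)⁻¹ • ·) (insertAlpha_eq K k (ellCoprod K) n)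

/-- The family with `κ` in arity `0` and zero in the other arities. -/
def kappaFamily : ∀ n, (coprod (cLinf K) (T K)).op.obj n (-1)
  | 0 => kappa K
  | _ + 1 => 0

theorem d_kappaFamily (n : ℕ) : (coprod (cLinf K) (T K)).d.toFun (kappaFamily K n) = 0 := by
  cases n with
  | zero => exact map_zero inr
  | succ n => exact map_zero _

theorem isSym_kappaFamily (n : ℕ) : (coprod (cLinf K) (T K)).op.IsSym (kappaFamily K n) := by
  cases n with
  | zero => exact GradedOperad.isSym_zero_ary _
  | succ n => exact fun σ => map_zero _

/-- The partial sums of the twisted operations. -/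
def twistedPartial (m : ℕ) : ∀ n, (coprod (cLinf K) (T K)).op.obj n (-1) :=
  kappaFamily K + ∑ k ∈ Finset.range m, twist (alpha K) (ellCoprod K) k

theorem isSym_twistedPartial (m n : ℕ) :
    (coprod (cLinf K) (T K)).op.IsSym (twistedPartial K m n) := by
  intro σ
  rw [twistedPartial, Pi.add_apply, map_add, isSym_kappaFamily K n σ, Finset.sum_apply, map_sum,
    Finset.sum_congr rfl fun k _ => isSym_twist (alpha K) (isSym_ellCoprod K) k n σ]

/-- The family of κ contributes only as right argument: as left argument it has no input to offer,
and as right argument it acts by insertion of κ. -/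
theorem bracket_twistedPartial (m : ℕ) :
    bracket (show (-1 : ℤ) + -1 = -1 - 1 by norm_num) (twistedPartial K m) (twistedPartial K m) =
      ∑ i ∈ Finset.range m, ∑ j ∈ Finset.range m,
        bracket (show (-1 : ℤ) + -1 = -1 - 1 by norm_num) (twist (alpha K) (ellCoprod K) i)
          (twist (alpha K) (ellCoprod K) j) +
      ∑ k ∈ Finset.range m, feed (show (-1 : ℤ) + -1 = -1 - 1 by norm_num) (kappa K)
        (twist (alpha K) (ellCoprod K) k) := by
  have hk : ∀ Y : ∀ n, (coprod (cLinf K) (T K)).op.obj n (-1),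
      bracket (show (-1 : ℤ) + -1 = -1 - 1 by norm_num) (kappaFamily K) Y = 0 :=
    fun Y => bracket_eq_zero _ fun _ => rfl
  have hk' : ∀ k, bracket (show (-1 : ℤ) + -1 = -1 - 1 by norm_num)
      (twist (alpha K) (ellCoprod K) k) (kappaFamily K) =
      feed (show (-1 : ℤ) + -1 = -1 - 1 by norm_num) (kappa K)
        (twist (alpha K) (ellCoprod K) k) := fun k =>
    bracket_of_eq_zero _ (isSym_twist _ (isSym_ellCoprod K) k) fun n hn => by
      obtain ⟨n, rfl⟩ := Nat.exists_eq_succ_of_ne_zero hn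
      rfl
  rw [twistedPartial, bracket_add_left, hk, zero_add, bracket_add_right, add_comm]
  -- In bilinear form, the bracket can be expanded over both finite sums with `map_sum`.
  change bracketHom _ _ _ + bracketHom _ _ _ = _
  simp only [map_sum, LinearMap.sum_apply]
  congr 1
  · rw [Finset.sum_comm]
    rfl
  · exact Finset.sum_congr rfl fun k _ => hk' k

/-- A term with k + 1 factors α yields a term in κ with k factors α, and the term without α yields
none. So m + 1 terms of the series produce m terms in κ, as many as there are in the bracket of the
partial sum with m terms. -/
theorem d_twistedPartial (m n : ℕ) :
    (coprod (cLinf K) (T K)).d.toFun (twistedPartial K (m + 1) n) =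
      - ∑ k ∈ Finset.range (m + 1), twistBracket (show (-1 : ℤ) + -1 = -1 - 1 by norm_num) (alpha K)
        (ellCoprod K) k n -
      ∑ k ∈ Finset.range m, feed (show (-1 : ℤ) + -1 = -1 - 1 by norm_num) (kappa K)
        (twist (alpha K) (ellCoprod K) k) n := by
  have e : ∀ k, (coprod (cLinf K) (T K)).d.toFun (twist (alpha K) (ellCoprod K) (k + 1) n) =
      - twistBracket (show (-1 : ℤ) + -1 = -1 - 1 by norm_num) (alpha K) (ellCoprod K) (k + 1) n -
        feed (show (-1 : ℤ) + -1 = -1 - 1 by norm_num) (kappa K)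
          (twist (alpha K) (ellCoprod K) k) n := fun k =>
    -- Here dα is κ by definition, including the degree 0 - 1 = -1.
    congrFun (family_twist_succ (alpha K) (coprod (cLinf K) (T K)).d (isSym_ellCoprod K)
      (family_ellCoprod K) k) n
  have e0 : (coprod (cLinf K) (T K)).d.toFun (twist (alpha K) (ellCoprod K) 0 n) =
      - twistBracket (show (-1 : ℤ) + -1 = -1 - 1 by norm_num) (alpha K) (ellCoprod K) 0 n :=
    congrFun (family_twist_zero (alpha K) (coprod (cLinf K) (T K)).d (family_ellCoprod K)) n
  rw [twistedPartial, Pi.add_apply, map_add, d_kappaFamily, zero_add, Finset.sum_apply, map_sum,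
    Finset.sum_range_succ', e0, Finset.sum_congr rfl fun k _ => e k, Finset.sum_sub_distrib,
    Finset.sum_neg_distrib, Finset.sum_range_succ' _ m]
  abel

/-- The terms in κ cancel exactly. What remains are brackets of the i-th and j-th components, over
i, j < m on one side and i + j ≤ m on the other; those on which the sides differ have i + j ≥ m,
hence at least m factors α. -/
theorem linfD_twistedPartial_sub_mem (m n : ℕ) :
    linfD (coprod (cLinf K) (T K)).op (twistedPartial K m) n -
      (coprod (cLinf K) (T K)).d.toFun (twistedPartial K (m + 1) n) ∈
      (alphaFiltration (cLinf K)).F m n (-1 - 1) := by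
  set F := alphaFiltration (cLinf K)
  have ht : ∀ k n, twist (alpha K) (ellCoprod K) k n ∈ F.F k n (-1) := fun k n => by
    rw [← twistTerm_eq]
    exact twistTerm_mem K n k
  have hb : ∀ i j, m ≤ i + j → bracket (show (-1 : ℤ) + -1 = -1 - 1 by norm_num)
      (twist (alpha K) (ellCoprod K) i) (twist (alpha K) (ellCoprod K) j) n ∈ F.F m n (-1 - 1) :=
    fun i j h => F.le_of_le h _ _ (F.bracket_mem _ (ht i) (ht j) n)
  have hS : twistBracket (show (-1 : ℤ) + -1 = -1 - 1 by norm_num) (alpha K) (ellCoprod K) m n ∈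
      F.F m n (-1 - 1) := by
    rw [twistBracket, Finset.sum_apply]
    exact Submodule.sum_mem _ fun ij hij =>
      hb _ _ (Finset.HasAntidiagonal.mem_antidiagonal.1 hij).ge
  -- In the quotient by F_m, the brackets with i + j ≥ m are zero, as the comparison of square and
  -- triangle requires.
  have key := sum_range_antidiagonal_eq m (fun i j => (F.F m n (-1 - 1)).mkQ
    (bracket (show (-1 : ℤ) + -1 = -1 - 1 by norm_num) (twist (alpha K) (ellCoprod K) i)
      (twist (alpha K) (ellCoprod K) j) n))
    (fun i j h => (Submodule.Quotient.mk_eq_zero _).2 (hb i j h))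
  rw [linfD_eq_bracket (isSym_twistedPartial K m), d_twistedPartial, bracket_twistedPartial,
    Finset.sum_range_succ, ← Submodule.ker_mkQ (F.F m n (-1 - 1)), LinearMap.mem_ker]
  rw [← Submodule.ker_mkQ (F.F m n (-1 - 1)), LinearMap.mem_ker, twistBracket,
    Finset.sum_apply, map_sum] at hS
  simp only [Pi.add_apply, Finset.sum_apply, map_sub, map_neg, map_add, hS, map_sum, ← key,
    twistBracket]
  abel

/-! ### Passage to the completion and the twisting morphism -/

/-- The family with `κ` in arity `0` and zero in the other arities, in the completion. -/
def kappaHatFamily (n : ℕ) : (completedCoprodT (cLinf K)).op.obj n (-1) :=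
  (alphaFiltration (cLinf K)).toCompleted (kappaFamily K n)

/-- The values of the twisting morphism on the generators. -/
def twistedGen (n : ℕ) : (completedCoprodT (cLinf K)).op.obj n (-1) :=
  kappaHatFamily K n + twistedEll K n

theorem twistedGen_apply (m n : ℕ) :
    (show (alphaFiltration (cLinf K)).completion n (-1) from twistedGen K n).1 m =
      Submodule.Quotient.mk (twistedPartial K m n) := by
  have e : ∑ k ∈ Finset.range m, twistTerm K n k =
      (∑ k ∈ Finset.range m, twist (alpha K) (ellCoprod K) k) n := by
    rw [Finset.sum_apply]
    exact Finset.sum_congr rfl fun k _ => twistTerm_eq K n k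
  rw [twistedPartial, Pi.add_apply, ← e]
  rfl

theorem isSym_twistedGen (n : ℕ) :
    (completedCoprodT (cLinf K)).op.IsSym (twistedGen K n) := fun σ =>
  (alphaFiltration (cLinf K)).completion_ext fun m => by
    change (alphaFiltration (cLinf K)).qAct m σ
      ((show (alphaFiltration (cLinf K)).completion n (-1) from twistedGen K n).1 m) =
      (show (alphaFiltration (cLinf K)).completion n (-1) from twistedGen K n).1 m
    rw [twistedGen_apply]
    exact congrArg Submodule.Quotient.mk (isSym_twistedPartial K m n σ)

/-- The m-th component of the formula depends on the m-th partial sums, whereas that of the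
differential comes from P / F_{m+1} and so from the partial sum with m + 1 terms. The congruence
`linfD_twistedPartial_sub_mem` compares exactly these two. -/
theorem linfD_twistedGen (n : ℕ) : linfD (completedCoprodT (cLinf K)).op (twistedGen K) n =
    (completedCoprodT (cLinf K)).d.toFun (twistedGen K n) :=
  (alphaFiltration (cLinf K)).completion_ext fun m => by
    refine ((alphaFiltration (cLinf K)).linfD_apply (twistedGen K) (twistedPartial K m) m
      (twistedGen_apply K m) n).trans ?_
    change _ = (alphaFiltration (cLinf K)).qD m
      ((show (alphaFiltration (cLinf K)).completion n (-1) from twistedGen K n).1 (m + 1))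
    rw [twistedGen_apply]
    exact (Submodule.Quotient.eq _).2 (linfD_twistedPartial_sub_mem K m n)

/-- The values of the twisting morphism on the generators, indexed by the type of generators. -/
def twistedVal : ∀ n a, LGen.{u} n a → (completedCoprodT (cLinf K)).op.obj n a
  | _, _, .ell n => twistedGen K n

theorem twistedVal_rel (n : ℕ) (a : ℤ) (x y : Term K LGen.{u} n a) (h : LRel K n a x y) :
    x.eval (twistedVal K) = y.eval (twistedVal K) := by
  cases h with
  | sym σ => exact isSym_twistedGen K _ σ

/-- The twisting morphism from `cL_∞` to the completed coproduct of `cL_∞` and `T`. -/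
def twistingHom : (cLinf K).Hom (completedCoprodT (cLinf K)) :=
  presentedHom (twistedVal K) (twistedVal_rel K) (by
    rintro n _ ⟨⟩
    -- Evaluation respects the formula for dℓ_n, so the chain map condition on ℓ_n becomes the
    -- quadratic equation for the twisted generators.
    refine Eq.trans ?_ (linfD_twistedGen K n)
    exact map_linfD (P := presented (LRel K)) (Q := (completedCoprodT (cLinf K)).op)
      (presentedEval (twistedVal K) (twistedVal_rel K))
      (by rintro n a σ ⟨x⟩; rfl) (by rintro m n r a b c h h' i ⟨x⟩ ⟨y⟩; rfl) (lgen K) n)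

theorem twistedGen_of_one_le {n : ℕ} (hn : 1 ≤ n) : twistedGen K n = twistedEll K n := by
  obtain ⟨n, rfl⟩ := Nat.exists_eq_succ_of_ne_zero (Nat.one_le_iff_ne_zero.1 hn)
  exact (congrArg (· + twistedEll K (n + 1))
    (map_zero (alphaFiltration (cLinf K)).toCompleted)).trans (zero_add _)

end TwistedMorphism

end SymOp

/-! ### Existence and uniqueness -/

theorem propositionA2 (K : Type u) [Field K] [CharZero K] :
    ∃! η : SymOp.DGOperad.Hom (SymOp.cLinf K) (SymOp.completedCoprodT (SymOp.cLinf K)),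
      η.toFun (SymOp.ell K 0) = SymOp.kappaHat K + SymOp.twistedEll K 0 ∧
      ∀ n : ℕ, 1 ≤ n → η.toFun (SymOp.ell K n) = SymOp.twistedEll K n := by
  refine ⟨SymOp.twistingHom K, ⟨rfl, fun n hn => SymOp.twistedGen_of_one_le K hn⟩, ?_⟩
  -- The two conditions together prescribe η on every generator ℓ_n, the case n = 0 being the one
  -- with the summand κ.
  rintro η ⟨h0, h1⟩
  refine SymOp.presentedHom_ext ?_
  rintro n _ ⟨⟩
  rcases Nat.eq_zero_or_pos n with rfl | hn
  · exact h0
  · exact (h1 n hn).trans (SymOp.twistedGen_of_one_le K hn).symm
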